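/- **Setting.** A *logically constrained simply-typed term rewriting system* (LCSTRS) $\mathcal R$ consists of: a set $\mathcal S$ of sorts with a subset $\mathcal S_\vartheta\ni\mathsf{bool}$ of theory sorts; disjoint sets $\mathcal F$ of function symbols and $\mathcal V$ of variables, each symbol and variable having a unique simple type over $\mathcal S$, with infinitely many variables of each type; a subset $\mathcal F_\vartheta\subseteq\mathcal F$ of theory symbols, whose types are of the form $A_1\to\dots\to A_n\to B$ with all $A_i,B\in\mathcal S_\vartheta$ (those with $n=0$ are the *values*); sets $\mathfrak X_A$ ($A\in\mathcal S_\vartheta$) with $\mathfrak X_{\mathsf{bool}}=\{0,1\}$, and an interpretation $[\![\cdot]\!]$ of theory symbols by functions of their types over these sets, bijective from the values of sort $A$ to $\mathfrak X_A$, with truth values $\mathfrak f,\mathfrak t$ interpreted by $0,1$; and a set of rules $\ell\to r\,[\varphi]$. In a rule, $\ell$ and $r$ are terms of the same type; $\varphi$ is a term of type $\mathsf{bool}$ built from theory symbols and variables whose types are theory sorts; variables in $\mathrm{Var}(r)\setminus\mathrm{Var}(\ell)$ have theory sorts as types; $\ell=f\,t_1\cdots t_n$ is a pattern headed by a function symbol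 and contains a symbol outside $\mathcal F_\vartheta$. Here $\trianglerighteq$ is the maximally applied subterm relation ($t$ itself and the maximally applied subterms of the $t_i$ when $t=h\,t_1\cdots t_n$ with $h$ a symbol or a variable), $\vartriangleright$ its strict part, and a pattern is a term each of whose such subterms is a variable or headed by a function symbol. The relation $\to_{\mathcal R}$ is the closure under contexts of $\ell\sigma\to r\sigma$, for type-preserving $\sigma$ such that $\sigma(x)$ is a value for all $x\in\mathrm{Var}(\varphi)\cup(\mathrm{Var}(r)\setminus\mathrm{Var}(\ell))$ and $[\![\varphi\sigma]\!]=1$, and of calculations $f\,v_1\cdots v_n\to v'$ with $f\in\mathcal F_\vartheta$, $n>0$, $v_i,v'$ values, and $[\![f\,v_1\cdots v_n]\!]=[\![v']\!]$. A symbol is *defined* if it heads the left-hand side of a rule. **Accessibility.** A *sort ordering* $\succsim$ is a quasi-ordering on $\mathcal S$ with well-founded strict part $\succ$. For a sort $A$ and a type $B=B_1\to\dots\to B_n\to C$ with $C$ a sort: $A\succsim_+B$ iff $A\succsim C$ and $A\succ_-B_i$ for all $i$; $A\succ_-B$ iff $A\succ C$ and $A\succsim_+B_i$ for all $i$. For $f:A_1\to\dots\to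 A_n\to B$ with $B$ a sort, $\mathrm{Acc}(f)=\{i: B\succsim_+A_i\}$. A term $t$ is an accessible subterm of $s$ if $s=t$, or $s=f\,s_1\cdots s_m$ and $t$ is an accessible subterm of $s_k$ for some $k\in\mathrm{Acc}(f)$. $\mathcal R$ is *accessible function passing (AFP) with $\succsim$* if for each rule $f\,s_1\cdots s_m\to r\,[\varphi]$, each $x\in(\mathrm{Var}(f\,s_1\cdots s_m)\cap\mathrm{Var}(r))\setminus\mathrm{Var}(\varphi)$ is an accessible subterm of some $s_k$. **Computability.** For a family $I=(I_A)_{A\in\mathcal S}$ of sets of terms, a term $t$ of sort $A$ is $I$-computable if $t\in I_A$, and a term $t:A\to B$ is if $t\,u$ is for every $I$-computable $u:A$. Write $s\Rrightarrow_I t$ if $s,t$ have base types, $s=f\,s_1\cdots s_m$, and $t=s_k\,t_1\cdots t_n$ with $k\in\mathrm{Acc}(f)$ and all $t_i$ $I$-computable. Let $\Phi(I)_A$ be the set of terms $t:A$ that terminate with respect to ${\to_{\mathcal R}}\cup{\Rrightarrow_I}$ and such that $t\to_{\mathcal R}^*f\,t_1\cdots t_n$ implies that $t_i$ is $I$-computable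 for all $i\in\mathrm{Acc}(f)$. $\mathbb C$ is the family with $\mathbb C=\Phi(\mathbb C)$ obtained by recursion along $\succ$, taking the least solution on each class of equivalent sorts; it is a set of reducibility candidates for $\to_{\mathcal R}$. $\mathbb C$ depends on $\mathcal R$ and $\succsim$. **Dependency pairs.** Each defined $f:A_1\to\dots\to A_n\to B$ ($B$ a sort) gets a fresh symbol $f^\sharp:A_1\to\dots\to A_n\to\mathsf{dp}$, with $\mathsf{dp}$ a fresh sort, and $(f\,t_1\cdots t_k)^\sharp=f^\sharp\,t_1\cdots t_k$. $\mathrm{SDP}(\mathcal R)$ is the set of all $\ell^\sharp x_1\cdots x_m\Rightarrow g^\sharp t_1\cdots t_q\,y_{q+1}\cdots y_n\,[\varphi\mid L]$, where $\ell\to r\,[\varphi]$ is a rule, $L=\mathrm{Var}(\varphi)\cup(\mathrm{Var}(r)\setminus\mathrm{Var}(\ell))$, $r\,x_1\cdots x_m\trianglerighteq g\,t_1\cdots t_q$, $g$ is defined, the $x_i,y_j$ are distinct fresh variables, and both sides have type $\mathsf{dp}$. An infinite $(\mathcal P,\mathcal R)$-*chain* is a sequence $(s_i^\sharp\Rightarrow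 t_i^\sharp\,[\varphi_i\mid L_i],\sigma_i)_{i\in\mathbb N}$ of elements of $\mathcal P$ and substitutions such that $\sigma_i(x)$ is a ground theory term for all $x\in L_i$, $[\![\varphi_i\sigma_i]\!]=1$, and $t_i^\sharp\sigma_i\to_{\mathcal R}^*s_{i+1}^\sharp\sigma_{i+1}$. It is *computable* if $u\sigma_i$ is $\mathbb C$-computable whenever $t_i\vartriangleright u$. Given a set of *hidden symbols*, it is *public* if the symbol $f$ with $s_0^\sharp=f^\sharp\cdots$ is not hidden. **Extensions.** $\mathcal R_1$ is an *extension* of $\mathcal R_0$ if the two agree on what they have in common (types, theory sets, interpretations of theory symbols, $\mathsf{bool}$) and no function symbol of $\mathcal R_0$ is defined by a rule of $\mathcal R_1$; it is a *public* extension if moreover no hidden symbol occurs in a rule of $\mathcal R_1$. The *hierarchical combination* $\mathcal R_0\cup\mathcal R_1$ is the union of both systems, required to be an LCSTRS (with further variables added where needed). A sort ordering $\succsim'$ on the sorts of $\mathcal R_0\cup\mathcal R_1$ *extends* $\succsim$ if both coincide on the sorts of $\mathcal R_0$. $\mathcal R_0$ with $\succsim$ is *publicly computable* if every term of $\mathcal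 R_0$ without hidden symbols is $\mathbb C$-computable in $\mathcal R_0\cup\mathcal R_1$ with $\succsim'$ for all public extensions $\mathcal R_1$ and all $\succsim'$ extending $\succsim$; it is *universally computable* if every term of $\mathcal R_0$ is $\mathbb C$-computable in $\mathcal R_0\cup\mathcal R_1$ with $\succsim'$ for all extensions $\mathcal R_1$ and all $\succsim'$ extending $\succsim$. **Theorem.** Let $\mathcal R_0$ be an LCSTRS that is AFP with a sort ordering $\succsim$. 1. Let a set of hidden symbols in $\mathcal R_0$ be given. Suppose that for each public extension $\mathcal R_1$ of $\mathcal R_0$ and each extension $\succsim'$ of $\succsim$ to the sorts of $\mathcal R_0\cup\mathcal R_1$, there is no infinite computable $(\mathrm{SDP}(\mathcal R_0),\mathcal R_0\cup\mathcal R_1)$-chain that is public. Then $\mathcal R_0$ is publicly computable with respect to these hidden symbols. 2. Suppose that for each extension $\mathcal R_1$ of $\mathcal R_0$ and each extension $\succsim'$ of $\succsim$ to the sorts of $\mathcal R_0\cup\mathcal R_1$, there is no infinite computable $(\mathrm{SDP}(\mathcal R_0),\mathcal R_0\cup\mathcal R_1)$-chain. Then $\mathcal R_0$ is universally computable. -/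

import Mathlib

/-! Logically constrained simply-typed term rewriting systems (LCSTRSs), computability with
accessibility, static dependency pairs and hierarchical combinations.

Names of sorts, function symbols, variables and theory elements are drawn from arbitrary types
`𝔖`, `𝔉`, `𝔙`, `𝔛`; every system uses some subsets of them, so that systems can be united. -/

namespace LC

section TermSyn

/-- Simple types over a set of sorts. -/
inductive Ty (𝔖 : Type*) where
  | base (A : 𝔖) : Ty 𝔖
  | arrow (A B : Ty 𝔖) : Ty 𝔖

/-- The argument types `A₁, …, Aₙ` of `A₁ → ⋯ → Aₙ → B`, where `B` is a sort. -/
def Ty.args {𝔖 : Type*} : Ty 𝔖 → List (Ty 𝔖)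
  | .base _ => []
  | .arrow A B => A :: B.args

/-- The sort `B` of `A₁ → ⋯ → Aₙ → B`. -/
def Ty.target {𝔖 : Type*} : Ty 𝔖 → 𝔖
  | .base A => A
  | .arrow _ B => B.target

/-- All sorts that occur in the type belong to `S`. -/
def Ty.Over {𝔖 : Type*} (S : Set 𝔖) : Ty 𝔖 → Prop
  | .base A => A ∈ S
  | .arrow A B => A.Over S ∧ B.Over S

/-- Theory types: `A₁ → ⋯ → Aₙ → B` with all of `A₁, …, Aₙ, B` theory sorts. -/
def Ty.IsTheory {𝔖 : Type*} (S : Set 𝔖) : Ty 𝔖 → Prop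
  | .base A => A ∈ S
  | .arrow (.base A) B => A ∈ S ∧ B.IsTheory S
  | .arrow (.arrow _ _) _ => False

/-- Pre-terms over function symbols and variables. -/
inductive PreTerm (𝔉 𝔙 : Type*) where
  | fn (f : 𝔉) : PreTerm 𝔉 𝔙
  | var (x : 𝔙) : PreTerm 𝔉 𝔙
  | app (s t : PreTerm 𝔉 𝔙) : PreTerm 𝔉 𝔙

variable {𝔉 𝔙 : Type*}

namespace PreTerm

/-- `apps t [t₁, …, tₙ]` is `t t₁ ⋯ tₙ`. -/
def apps (t : PreTerm 𝔉 𝔙) (ts : List (PreTerm 𝔉 𝔙)) : PreTerm 𝔉 𝔙 :=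
  ts.foldl app t

/-- Variables of a term. -/
def fv : PreTerm 𝔉 𝔙 → Set 𝔙
  | fn _ => ∅
  | var x => {x}
  | app s t => s.fv ∪ t.fv

/-- Function symbols of a term. -/
def fns : PreTerm 𝔉 𝔙 → Set 𝔉
  | fn f => {f}
  | var _ => ∅
  | app s t => s.fns ∪ t.fns

/-- Application of a substitution. -/
def subst (σ : 𝔙 → PreTerm 𝔉 𝔙) : PreTerm 𝔉 𝔙 → PreTerm 𝔉 𝔙
  | fn f => fn f
  | var x => σ x
  | app s t => app (s.subst σ) (t.subst σ)

/-- `s.Sub t`: `t` is a (maximally applied) subterm of `s`. -/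
def Sub : PreTerm 𝔉 𝔙 → PreTerm 𝔉 𝔙 → Prop
  | fn f, t => fn f = t
  | var x, t => var x = t
  | app s₀ s₁, t => app s₀ s₁ = t ∨ s₁.Sub t ∨ (s₀.Sub t ∧ s₀ ≠ t)

/-- `s.ProperSub t`: `t` is a proper subterm of `s`. -/
def ProperSub (s t : PreTerm 𝔉 𝔙) : Prop := s.Sub t ∧ s ≠ t

/-- Patterns: each subterm is a variable or has a function symbol as its head. -/
def IsPattern (t : PreTerm 𝔉 𝔙) : Prop :=
  ∀ u, t.Sub u → (∃ f ts, u = apps (fn f) ts) ∨ ∃ x, u = var x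

/-- Neutral terms: `x t₁ ⋯ tₙ` with `x` a variable. -/
def IsNeutral (t : PreTerm 𝔉 𝔙) : Prop := ∃ x ts, t = apps (var x) ts

end PreTerm

/-- A triple `ℓ → r [φ]`. -/
structure Rule (𝔉 𝔙 : Type*) where
  lhs : PreTerm 𝔉 𝔙
  rhs : PreTerm 𝔉 𝔙
  constr : PreTerm 𝔉 𝔙

/-- The rule defines `f`: its left-hand side is `f t₁ ⋯ tₙ`. -/
def Rule.Defines (ρ : Rule 𝔉 𝔙) (f : 𝔉) : Prop :=
  ∃ ts, ρ.lhs = PreTerm.apps (.fn f) ts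

/-- The function symbols that occur in the rule. -/
def Rule.fns (ρ : Rule 𝔉 𝔙) : Set 𝔉 := ρ.lhs.fns ∪ ρ.rhs.fns ∪ ρ.constr.fns

/-- The variables that a respecting substitution has to instantiate with values. -/
def Rule.logVars (ρ : Rule 𝔉 𝔙) : Set 𝔙 := ρ.constr.fv ∪ (ρ.rhs.fv \ ρ.lhs.fv)

end TermSyn

/-- Sorts, function symbols and variables with their types, together with the underlying theory.
`fty`, `vty`, `carrier` and `interp` are meaningful only on the symbols, variables, theory sorts
and theory symbols of the signature.  The mapping that interprets a theory symbol of type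
`A₁ → ⋯ → Aₙ → B` is written in uncurried form: it takes the list of its `n` arguments. -/
structure Signature (𝔖 𝔉 𝔙 𝔛 : Type*) where
  sorts : Set 𝔖
  thSorts : Set 𝔖
  thSorts_sub : thSorts ⊆ sorts
  funs : Set 𝔉
  thFuns : Set 𝔉
  thFuns_sub : thFuns ⊆ funs
  vars : Set 𝔙
  fty : 𝔉 → Ty 𝔖
  vty : 𝔙 → Ty 𝔖
  fty_over : ∀ f ∈ funs, (fty f).Over sorts
  vty_over : ∀ x ∈ vars, (vty x).Over sorts
  /-- There are infinitely many variables of each type. -/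
  vars_infinite : ∀ A : Ty 𝔖, A.Over sorts → {x | x ∈ vars ∧ vty x = A}.Infinite
  thFuns_ty : ∀ f ∈ thFuns, (fty f).IsTheory thSorts
  /-- The set of elements that a theory sort stands for. -/
  carrier : 𝔖 → Set 𝔛
  /-- The interpretation of theory symbols. -/
  interp : 𝔉 → List 𝔛 → 𝔛
  interp_mem : ∀ f ∈ thFuns, ∀ as : List 𝔛,
    List.Forall₂ (fun a B => a ∈ carrier (Ty.target B)) as (fty f).args →
      interp f as ∈ carrier (fty f).target
  /-- Values of a theory sort correspond one-to-one to its elements. -/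
  interp_bij : ∀ A ∈ thSorts,
    Set.BijOn (fun f => interp f []) {f | f ∈ thFuns ∧ fty f = .base A} (carrier A)
  bool : 𝔖
  bool_mem : bool ∈ thSorts
  ff : 𝔉
  ff_mem : ff ∈ thFuns
  ff_ty : fty ff = .base bool
  tt : 𝔉
  tt_mem : tt ∈ thFuns
  tt_ty : fty tt = .base bool
  zero : 𝔛
  one : 𝔛
  zero_ne_one : zero ≠ one
  carrier_bool : carrier bool = {zero, one}
  interp_ff : interp ff [] = zero
  interp_tt : interp tt [] = one

namespace Signature

variable {𝔖 𝔉 𝔙 𝔛 : Type*} (T : Signature 𝔖 𝔉 𝔙 𝔛)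

/-- `T.HasType t A`: `t` is a term over the signature, of type `A`. -/
inductive HasType : PreTerm 𝔉 𝔙 → Ty 𝔖 → Prop
  | fn {f : 𝔉} : f ∈ T.funs → HasType (.fn f) (T.fty f)
  | var {x : 𝔙} : x ∈ T.vars → HasType (.var x) (T.vty x)
  | app {s t : PreTerm 𝔉 𝔙} {A B : Ty 𝔖} :
      HasType s (.arrow A B) → HasType t A → HasType (.app s t) B

/-- The interpretation of ground theory terms: `T.eval t [a₁, …, aₙ]` is `⟦t⟧(a₁)⋯(aₙ)`.
(The clause for variables is a default that is not used.) -/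
def eval : PreTerm 𝔉 𝔙 → List 𝔛 → 𝔛
  | .fn f, as => T.interp f as
  | .var _, _ => T.zero
  | .app s t, as => eval s (eval t [] :: as)

/-- Values: theory symbols whose type is a (theory) sort. -/
def IsValue (t : PreTerm 𝔉 𝔙) : Prop :=
  ∃ f ∈ T.thFuns, (∃ A, T.fty f = .base A) ∧ t = .fn f

/-- Ground theory terms. -/
def IsGroundTheory (t : PreTerm 𝔉 𝔙) : Prop :=
  (∃ A, T.HasType t A) ∧ t.fns ⊆ T.thFuns ∧ t.fv = ∅

/-- The type of the variable is a theory sort. -/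
def IsTheoryVar (x : 𝔙) : Prop := ∃ A ∈ T.thSorts, T.vty x = .base A

/-- Logical constraints. -/
def IsConstraint (φ : PreTerm 𝔉 𝔙) : Prop :=
  T.HasType φ (.base T.bool) ∧ φ.fns ⊆ T.thFuns ∧ ∀ x ∈ φ.fv, T.IsTheoryVar x

/-- Type-preserving mappings from variables to terms. -/
def IsSubst (σ : 𝔙 → PreTerm 𝔉 𝔙) : Prop := ∀ x ∈ T.vars, T.HasType (σ x) (T.vty x)

/-- Constrained rewrite rules over the signature. -/
structure IsRule (ρ : Rule 𝔉 𝔙) : Prop where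
  same_type : ∃ A, T.HasType ρ.lhs A ∧ T.HasType ρ.rhs A
  constr : T.IsConstraint ρ.constr
  fresh : ∀ x ∈ ρ.rhs.fv \ ρ.lhs.fv, T.IsTheoryVar x
  pattern : ρ.lhs.IsPattern
  head : ∃ f, ρ.Defines f
  not_theory : ∃ f ∈ ρ.lhs.fns, f ∉ T.thFuns

/-- The substitution respects the rewrite rule. -/
def RespectsRule (σ : 𝔙 → PreTerm 𝔉 𝔙) (ρ : Rule 𝔉 𝔙) : Prop :=
  (∀ x ∈ ρ.logVars, T.IsValue (σ x)) ∧ T.eval (ρ.constr.subst σ) [] = T.one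

end Signature

/-- A logically constrained simply-typed term rewriting system. -/
structure LCSTRS (𝔖 𝔉 𝔙 𝔛 : Type*) extends Signature 𝔖 𝔉 𝔙 𝔛 where
  rules : Set (Rule 𝔉 𝔙)
  rules_valid : ∀ ρ ∈ rules, toSignature.IsRule ρ

/-- A sort ordering over `S`: a quasi-ordering over `S` whose strict part is well-founded. -/
structure SortOrdering {𝔖 : Type*} (S : Set 𝔖) where
  ge : 𝔖 → 𝔖 → Prop
  mem_of_ge : ∀ A B, ge A B → A ∈ S ∧ B ∈ S
  refl : ∀ A ∈ S, ge A A
  trans : ∀ A B C, ge A B → ge B C → ge A C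
  wf : WellFounded (fun B A => ge A B ∧ ¬ ge B A)

namespace SortOrdering

variable {𝔖 : Type*} {S : Set 𝔖} (o : SortOrdering S)

/-- The strict part. -/
def gt (A B : 𝔖) : Prop := o.ge A B ∧ ¬ o.ge B A

mutual
/-- The relation `A ≽₊ B` between a sort and a type. -/
def Pos (A : 𝔖) : Ty 𝔖 → Prop
  | .base C => o.ge A C
  | .arrow B C => Neg A B ∧ Pos A C
/-- The relation `A ≽₋ B` between a sort and a type. -/
def Neg (A : 𝔖) : Ty 𝔖 → Prop
  | .base C => o.gt A C
  | .arrow B C => Pos A B ∧ Neg A C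
end

/-- `o'` is an extension of `o`: both coincide over the sorts of `o`. -/
def Extends {S' : Set 𝔖} (o' : SortOrdering S') (o : SortOrdering S) : Prop :=
  ∀ A ∈ S, ∀ B ∈ S, o'.ge A B ↔ o.ge A B

end SortOrdering

namespace LCSTRS

variable {𝔖 𝔉 𝔙 𝔛 : Type*}

section Rewriting

variable (R : LCSTRS 𝔖 𝔉 𝔙 𝔛)

/-- Defined symbols. -/
def IsDefined (f : 𝔉) : Prop := ∃ ρ ∈ R.rules, ρ.Defines f

/-- The rewrite relation (on terms of the system): the closure under contexts of rule
applications and calculations. -/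
inductive Step : PreTerm 𝔉 𝔙 → PreTerm 𝔉 𝔙 → Prop
  | rule {ρ : Rule 𝔉 𝔙} {σ : 𝔙 → PreTerm 𝔉 𝔙} : ρ ∈ R.rules → R.IsSubst σ →
      R.RespectsRule σ ρ → Step (ρ.lhs.subst σ) (ρ.rhs.subst σ)
  | calculation {f : 𝔉} {vs : List (PreTerm 𝔉 𝔙)} {v' : PreTerm 𝔉 𝔙} {A : 𝔖} : f ∈ R.thFuns →
      vs ≠ [] → (∀ v ∈ vs, R.IsValue v) → R.IsValue v' →
      R.HasType (PreTerm.apps (.fn f) vs) (.base A) → R.HasType v' (.base A) →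
      R.eval (PreTerm.apps (.fn f) vs) [] = R.eval v' [] →
      Step (PreTerm.apps (.fn f) vs) v'
  | appL {s s' t : PreTerm 𝔉 𝔙} : Step s s' → Step (.app s t) (.app s' t)
  | appR {s t t' : PreTerm 𝔉 𝔙} : Step t t' → Step (.app s t) (.app s t')

/-- Termination of a term: there is no infinite sequence `t = t₀, t₁, …` with `r tᵢ tᵢ₊₁`. -/
def Terminating (r : PreTerm 𝔉 𝔙 → PreTerm 𝔉 𝔙 → Prop) (t : PreTerm 𝔉 𝔙) : Prop :=
  Acc (fun b a => r a b) t

end Rewriting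

section Computability

variable (R : LCSTRS 𝔖 𝔉 𝔙 𝔛) (o : SortOrdering R.sorts)

/-- `k` (counted from 0) is an accessible argument position of `f`. -/
def AccPos (f : 𝔉) (k : ℕ) : Prop :=
  ∃ B, (R.fty f).args[k]? = some B ∧ o.Pos (R.fty f).target B

/-- `AccSub s t`: `t` is an accessible subterm of `s`. -/
inductive AccSub : PreTerm 𝔉 𝔙 → PreTerm 𝔉 𝔙 → Prop
  | refl (s : PreTerm 𝔉 𝔙) : AccSub s s
  | arg {f : 𝔉} {ss : List (PreTerm 𝔉 𝔙)} {k : ℕ} {u t : PreTerm 𝔉 𝔙} :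
      f ∈ R.funs → R.AccPos o f k → ss[k]? = some u → AccSub u t →
      AccSub (PreTerm.apps (.fn f) ss) t

/-- The system is accessible function passing with the given sort ordering. -/
def IsAFP : Prop :=
  ∀ ρ ∈ R.rules, ∀ f ss, ρ.lhs = PreTerm.apps (.fn f) ss →
    ∀ x ∈ (ρ.lhs.fv ∩ ρ.rhs.fv) \ ρ.constr.fv, ∃ s ∈ ss, R.AccSub o s (.var x)

/-- `I`-computability of a term at a type. -/
def CompAt (I : 𝔖 → Set (PreTerm 𝔉 𝔙)) : Ty 𝔖 → PreTerm 𝔉 𝔙 → Prop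
  | .base A, t => R.HasType t (.base A) ∧ t ∈ I A
  | .arrow A B, t => R.HasType t (.arrow A B) ∧ ∀ u, CompAt I A u → CompAt I B (.app t u)

/-- `I`-computable terms. -/
def Comp (I : 𝔖 → Set (PreTerm 𝔉 𝔙)) (t : PreTerm 𝔉 𝔙) : Prop := ∃ A, R.CompAt I A t

/-- Sets of reducibility candidates for the rewrite relation of the system. -/
structure IsRC (I : 𝔖 → Set (PreTerm 𝔉 𝔙)) : Prop where
  terminating : ∀ A, ∀ t ∈ I A, R.HasType t (.base A) ∧ Terminating R.Step t
  closed : ∀ A, ∀ s ∈ I A, ∀ t, R.Step s t → t ∈ I A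
  neutral : ∀ A s, R.HasType s (.base A) → s.IsNeutral →
    (∀ t, R.Step s t → t ∈ I A) → s ∈ I A

/-- The relation `s ⇛ t` for a family `I`: both terms have base types, `s = f s₁ ⋯ sₘ` and
`t = sₖ t₁ ⋯ tₙ`, where `k` is accessible for `f` and all `tᵢ` are `I`-computable. -/
def AccStep (I : 𝔖 → Set (PreTerm 𝔉 𝔙)) (s t : PreTerm 𝔉 𝔙) : Prop :=
  (∃ A, R.HasType s (.base A)) ∧ (∃ B, R.HasType t (.base B)) ∧
    ∃ f ss k u ts, s = PreTerm.apps (.fn f) ss ∧ R.AccPos o f k ∧ ss[k]? = some u ∧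
      t = PreTerm.apps u ts ∧ ∀ w ∈ ts, R.Comp I w

/-- The terms of sort `A` that terminate with respect to the union of the rewrite relation and
`⇛`, and all of whose reducts of the form `f t₁ ⋯ tₙ` have `I`-computable accessible
arguments. -/
def Phi (I : 𝔖 → Set (PreTerm 𝔉 𝔙)) (A : 𝔖) : Set (PreTerm 𝔉 𝔙) :=
  {t | R.HasType t (.base A) ∧ Terminating (fun s t => R.Step s t ∨ R.AccStep o I s t) t ∧
    ∀ t', Relation.ReflTransGen R.Step t t' → ∀ f ts, t' = PreTerm.apps (.fn f) ts →
      ∀ k u, R.AccPos o f k → ts[k]? = some u → R.Comp I u}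

/-- The set `ℂ` of reducibility candidates, a solution of `ℂ = Phi ℂ`.  It is built by
well-founded recursion along the sort ordering: given `ℂ` at all smaller sorts, the sets at the
sorts equivalent to `A` form the least solution. -/
noncomputable def C : 𝔖 → Set (PreTerm 𝔉 𝔙) :=
  o.wf.fix fun A ih => {t | ∀ X : 𝔖 → Set (PreTerm 𝔉 𝔙),
    (∀ B (h : o.ge A B ∧ ¬ o.ge B A), X B = ih B h) →
    (∀ B, o.ge A B → o.ge B A → R.Phi o X B ⊆ X B) → t ∈ X A}

end Computability

end LCSTRS

section Justification

variable {𝔖 𝔉 𝔙 𝔛 : Type*}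

theorem SortOrdering.pos_neg_mono {S : Set 𝔖} (o : SortOrdering S) {A B : 𝔖} (h : o.ge A B) :
    ∀ T : Ty 𝔖, (o.Pos B T → o.Pos A T) ∧ (o.Neg B T → o.Neg A T)
  | .base C => by
      simp only [SortOrdering.Pos, SortOrdering.Neg, SortOrdering.gt]
      exact ⟨fun h' => o.trans _ _ _ h h', fun h' => ⟨o.trans _ _ _ h h'.1, fun h2 =>
        h'.2 (o.trans _ _ _ h2 h)⟩⟩
  | .arrow T U => by
      have h1 := SortOrdering.pos_neg_mono o h T
      have h2 := SortOrdering.pos_neg_mono o h U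
      simp only [SortOrdering.Pos, SortOrdering.Neg]
      exact ⟨fun h' => ⟨h1.2 h'.1, h2.1 h'.2⟩, fun h' => ⟨h1.1 h'.1, h2.2 h'.2⟩⟩

theorem Signature.HasType.unique {T : Signature 𝔖 𝔉 𝔙 𝔛} {t : PreTerm 𝔉 𝔙} {A B : Ty 𝔖}
    (h : T.HasType t A) (h' : T.HasType t B) : A = B := by
  induction h generalizing B with
  | fn _ => cases h'; rfl
  | var _ => cases h'; rfl
  | app _ _ ih _ =>
    cases h' with
    | app h1 h2 => have := ih h1; injection this

theorem Signature.HasType.subst {T : Signature 𝔖 𝔉 𝔙 𝔛} {t : PreTerm 𝔉 𝔙} {A : Ty 𝔖}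
    (h : T.HasType t A) {σ} (hσ : T.IsSubst σ) : T.HasType (t.subst σ) A := by
  induction h with
  | fn h => exact .fn h
  | var h => exact hσ _ h
  | app _ _ ih1 ih2 => exact .app ih1 ih2

theorem LCSTRS.Step.hasType {R : LCSTRS 𝔖 𝔉 𝔙 𝔛} {s t : PreTerm 𝔉 𝔙} (hst : R.Step s t) :
    ∀ {A}, R.HasType s A → R.HasType t A := by
  induction hst with
  | rule hρ hσ _ =>
    intro A h
    obtain ⟨B, h1, h2⟩ := (R.rules_valid _ hρ).same_type
    rw [h.unique (h1.subst hσ)]; exact h2.subst hσ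
  | calculation _ _ _ _ h1 h2 _ => intro A h; rw [h.unique h1]; exact h2
  | appL _ ih => intro A h; cases h with | app h1 h2 => exact .app (ih h1) h2
  | appR _ ih => intro A h; cases h with | app h1 h2 => exact .app h1 (ih h2)

theorem LCSTRS.steps_hasType {R : LCSTRS 𝔖 𝔉 𝔙 𝔛} {s t : PreTerm 𝔉 𝔙} {A}
    (hst : Relation.ReflTransGen R.Step s t) (h : R.HasType s A) : R.HasType t A := by
  induction hst with
  | refl => exact h
  | tail _ h2 ih => exact h2.hasType ih

theorem Signature.hasType_apps {T : Signature 𝔖 𝔉 𝔙 𝔛} {B : Ty 𝔖} :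
    ∀ {ts : List (PreTerm 𝔉 𝔙)} {h : PreTerm 𝔉 𝔙}, T.HasType (PreTerm.apps h ts) B →
      ∃ As, T.HasType h (As.foldr Ty.arrow B) ∧ List.Forall₂ T.HasType ts As
  | [], h, hh => ⟨[], hh, .nil⟩
  | t :: ts, h, hh => by
      obtain ⟨As, h1, h2⟩ := hasType_apps (ts := ts) (h := .app h t) hh
      cases h1 with
      | app h3 h4 => exact ⟨_ :: As, h3, .cons h4 h2⟩

theorem Ty.foldr_args (As : List (Ty 𝔖)) (B : 𝔖) :
    (As.foldr Ty.arrow (.base B)).args = As ∧ (As.foldr Ty.arrow (.base B)).target = B := by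
  induction As with
  | nil => simp [Ty.args, Ty.target]
  | cons A As ih => simpa [Ty.args, Ty.target] using ih

theorem SortOrdering.pos_foldr {S : Set 𝔖} (o : SortOrdering S) {A C : 𝔖} (As : List (Ty 𝔖))
    (h : o.Pos A (As.foldr Ty.arrow (.base C))) : o.ge A C ∧ ∀ T ∈ As, o.Neg A T := by
  induction As with
  | nil => simpa [SortOrdering.Pos] using h
  | cons B As ih =>
    simp only [List.foldr, SortOrdering.Pos] at h
    have := ih h.2
    simp_all

namespace LCSTRS
variable (R : LCSTRS 𝔖 𝔉 𝔙 𝔛) (o : SortOrdering R.sorts)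

theorem CompAt.hasType {R : LCSTRS 𝔖 𝔉 𝔙 𝔛} {X : 𝔖 → Set (PreTerm 𝔉 𝔙)} :
    ∀ {T : Ty 𝔖} {t}, R.CompAt X T t → R.HasType t T
  | .base _, _, h => h.1
  | .arrow _ _, _, h => h.1

/-- `X` and `Y` coincide below `A`, and `X ⊆ Y` at the sorts equivalent to `A`. -/
structure Le (A : 𝔖) (X Y : 𝔖 → Set (PreTerm 𝔉 𝔙)) : Prop where
  low : ∀ B, o.ge A B → ¬ o.ge B A → X B = Y B
  eqv : ∀ B, o.ge A B → o.ge B A → X B ⊆ Y B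

variable {R o}
theorem Le.comp {A} {X Y : 𝔖 → Set (PreTerm 𝔉 𝔙)} (h : R.Le o A X Y) : ∀ (T : Ty 𝔖),
    (o.Pos A T → ∀ t, R.CompAt X T t → R.CompAt Y T t) ∧
    (o.Neg A T → ∀ t, R.CompAt Y T t → R.CompAt X T t)
  | .base C => by
      simp only [SortOrdering.Pos, SortOrdering.Neg, CompAt]
      refine ⟨fun h1 t ht => ⟨ht.1, ?_⟩, fun h1 t ht => ⟨ht.1, ?_⟩⟩
      · by_cases h2 : o.ge C A
        · exact h.eqv _ h1 h2 ht.2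
        · rw [← h.low _ h1 h2]; exact ht.2
      · rw [h.low _ h1.1 h1.2]; exact ht.2
  | .arrow T U => by
      have h1 := Le.comp h T
      have h2 := Le.comp h U
      simp only [SortOrdering.Pos, SortOrdering.Neg, CompAt]
      exact ⟨fun h3 t ht => ⟨ht.1, fun u hu => h2.1 h3.2 _ (ht.2 u (h1.2 h3.1 u hu))⟩,
        fun h3 t ht => ⟨ht.1, fun u hu => h2.2 h3.2 _ (ht.2 u (h1.1 h3.1 u hu))⟩⟩

/-- Accessible arguments of a term of sort `B` have a type `T` with `B ≽₊ T`. -/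
theorem accArg {f : 𝔉} {ss : List (PreTerm 𝔉 𝔙)} {k : ℕ} {u : PreTerm 𝔉 𝔙} {B : 𝔖}
    (h : R.HasType (PreTerm.apps (.fn f) ss) (.base B)) (hk : R.AccPos o f k)
    (hu : ss[k]? = some u) : ∃ T, R.HasType u T ∧ o.Pos B T := by
  obtain ⟨As, h1, h2⟩ := Signature.hasType_apps h
  have e : R.fty f = As.foldr Ty.arrow (.base B) := by
    generalize hT : As.foldr Ty.arrow (.base B) = T at h1
    cases h1; rfl
  obtain ⟨T, hT, hP⟩ := hk
  rw [e, (Ty.foldr_args As B).1] at hT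
  rw [e, (Ty.foldr_args As B).2] at hP
  refine ⟨T, ?_, hP⟩
  obtain ⟨hlt, rfl⟩ := List.getElem?_eq_some_iff.1 hu
  obtain ⟨hlt', rfl⟩ := List.getElem?_eq_some_iff.1 hT
  exact (List.forall₂_iff_get.1 h2).2 k hlt hlt'

theorem Le.accStep {A} {X Y : 𝔖 → Set (PreTerm 𝔉 𝔙)} (h : R.Le o A X Y) {B s t}
    (hAB : o.ge A B) (hs : R.HasType s (.base B)) (hst : R.AccStep o Y s t) :
    R.AccStep o X s t ∧ ∃ C, o.ge A C ∧ R.HasType t (.base C) := by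
  obtain ⟨h1, ⟨C, hC⟩, f, ss, k, u, ts, rfl, hk, hu, rfl, hw⟩ := hst
  obtain ⟨T, hT, hP⟩ := accArg hs hk hu
  obtain ⟨As, h3, h4⟩ := Signature.hasType_apps hC
  obtain rfl := hT.unique h3
  have hP' := (o.pos_neg_mono hAB _).1 hP
  obtain ⟨h5, h6⟩ := o.pos_foldr _ hP'
  refine ⟨⟨h1, ⟨C, hC⟩, f, ss, k, u, ts, rfl, hk, hu, rfl, fun w hwm => ?_⟩, C, h5, hC⟩
  obtain ⟨i, hi, rfl⟩ := List.getElem_of_mem hwm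
  obtain ⟨U, hU⟩ := hw _ hwm
  have hlen := h4.length_eq
  have h7 := (List.forall₂_iff_get.1 h4).2 i hi (hlen ▸ hi)
  have h8 := hU.hasType.unique h7
  subst h8
  exact ⟨_, (h.comp _).2 (h6 _ (List.getElem_mem _)) _ hU⟩

theorem Le.phi {A} {X Y : 𝔖 → Set (PreTerm 𝔉 𝔙)} (h : R.Le o A X Y) {B} (hAB : o.ge A B) :
    R.Phi o X B ⊆ R.Phi o Y B := by
  rintro t ⟨h1, h2, h3⟩
  refine ⟨h1, ?_, fun t' ht' f ts e k u hk hu => ?_⟩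
  · unfold Terminating at h2 ⊢
    clear h3
    induction h2 generalizing B with
    | intro t _ ih =>
      refine ⟨_, fun t' ht' => ?_⟩
      rcases ht' with ht' | ht'
      · exact ih t' (.inl ht') hAB (ht'.hasType h1)
      · obtain ⟨h4, C, h5, h6⟩ := h.accStep hAB h1 ht'
        exact ih t' (.inr h4) h5 h6
  · subst e
    obtain ⟨T, hT, hP⟩ := accArg (steps_hasType ht' h1) hk hu
    obtain ⟨U, hU⟩ := h3 _ ht' f ts rfl k u hk hu
    obtain rfl := hT.unique hU.hasType
    exact ⟨_, (h.comp _).1 ((o.pos_neg_mono hAB _).1 hP) _ hU⟩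

variable (R o)
theorem mem_C {A t} : t ∈ R.C o A ↔ ∀ X : 𝔖 → Set (PreTerm 𝔉 𝔙),
    (∀ B, o.ge A B → ¬ o.ge B A → X B = R.C o B) →
    (∀ B, o.ge A B → o.ge B A → R.Phi o X B ⊆ X B) → t ∈ X A := by
  unfold C
  rw [WellFounded.fix_eq]
  constructor
  · intro h X h1 h2; exact h X (fun B hB => h1 B hB.1 hB.2) h2
  · intro h X h1 h2; exact h X (fun B hB hB' => h1 B ⟨hB, hB'⟩) h2

/-- `ℂ` solves its defining equation: `t ∈ ℂ A` if and only if `t : A` terminates with respect to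
the union of the rewrite relation and `⇛`, and all reducts `f t₁ ⋯ tₙ` of `t` have `ℂ`-computable
accessible arguments. -/
theorem C_eq (A : 𝔖) : R.C o A = R.Phi o (R.C o) A := by
  have key : ∀ A X, (∀ B, o.ge A B → ¬ o.ge B A → X B = R.C o B) →
      (∀ B, o.ge A B → o.ge B A → R.Phi o X B ⊆ X B) → R.Le o A (R.C o) X := by
    intro A X h1 h2
    refine ⟨fun B hB hB' => (h1 B hB hB').symm, fun B hB hB' t ht => ?_⟩
    refine (R.mem_C o).1 ht X (fun D hD hD' => h1 D (o.trans _ _ _ hB hD)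
      fun h => hD' (o.trans _ _ _ h hB)) (fun D hD hD' => h2 D (o.trans _ _ _ hB hD)
      (o.trans _ _ _ hD' hB'))
  have pre : ∀ A, R.Phi o (R.C o) A ⊆ R.C o A := by
    intro A t ht
    have hA : A ∈ R.sorts := by
      have h : ∀ {t T}, R.HasType t T → T.Over R.sorts := by
        intro t T h
        induction h with
        | fn h => exact R.fty_over _ h
        | var h => exact R.vty_over _ h
        | app _ _ ih _ => exact ih.2
      exact h ht.1
    refine (R.mem_C o).2 fun X h1 h2 => ?_
    exact h2 A (o.refl A hA) (o.refl A hA) ((key A X h1 h2).phi (o.refl A hA) ht)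
  refine Set.Subset.antisymm ?_ (pre A)
  intro t ht
  by_cases hA : A ∈ R.sorts
  · classical
    let X : 𝔖 → Set (PreTerm 𝔉 𝔙) := fun B => if o.ge A B ∧ o.ge B A then R.Phi o (R.C o) B
      else R.C o B
    have hX : R.Le o A X (R.C o) := by
      refine ⟨fun B h1 h2 => by simp [X, h2], fun B h1 h2 => ?_⟩
      simp only [X, h1, h2, and_self, if_true]; exact pre B
    have := (R.mem_C o).1 ht X hX.low (fun B h1 h2 => by
      have := hX.phi h1
      simp only [X, h1, h2, and_self, if_true]; exact this)
    simpa [X, o.refl A hA] using this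
  · have := (R.mem_C o).1 ht (fun B => ∅) (fun B h => absurd (o.mem_of_ge _ _ h).1 hA)
      (fun B h => absurd (o.mem_of_ge _ _ h).1 hA)
    exact absurd this (by simp)

theorem not_neutral_fn {f : 𝔉} {ss : List (PreTerm 𝔉 𝔙)} :
    ¬ (PreTerm.apps (.fn f) ss : PreTerm 𝔉 𝔙).IsNeutral := by
  rintro ⟨x, ts, e⟩
  induction ss using List.reverseRecOn generalizing ts with
  | nil =>
    rcases List.eq_nil_or_concat ts with rfl | ⟨l, a, rfl⟩ <;> simp [PreTerm.apps] at e
  | append_singleton l a ih =>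
    rcases List.eq_nil_or_concat ts with rfl | ⟨l', a', rfl⟩
    · simp [PreTerm.apps] at e
    · simp [PreTerm.apps] at e
      exact ih _ (by simpa [PreTerm.apps] using e.1)

/-- `ℂ` is a set of reducibility candidates. -/
theorem C_isRC : R.IsRC (R.C o) := by
  refine ⟨fun A t ht => ?_, fun A s hs t hst => ?_, fun A s hs hn h => ?_⟩
  · rw [C_eq] at ht
    exact ⟨ht.1, Subrelation.accessible (fun h => Or.inl h) ht.2.1⟩
  · rw [C_eq] at hs ⊢
    exact ⟨hst.hasType hs.1, hs.2.1.inv (.inl hst), fun t' ht' =>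
      hs.2.2 t' (.head hst ht')⟩
  · rw [C_eq]
    refine ⟨hs, ⟨_, fun t ht => ?_⟩, fun t' ht' f ts e k u hk hu => ?_⟩
    · rcases ht with ht | ht
      · have := h t ht
        rw [C_eq] at this; exact this.2.1
      · obtain ⟨_, _, f, ss, k, u, ts, rfl, _⟩ := ht
        exact absurd hn not_neutral_fn
    · rcases Relation.ReflTransGen.cases_head ht' with rfl | ⟨t, h1, h2⟩
      · subst e; exact absurd hn not_neutral_fn
      · have := h t h1
        rw [C_eq] at this
        exact this.2.2 t' h2 f ts e k u hk hu
end LCSTRS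

end Justification

namespace LCSTRS

variable {𝔖 𝔉 𝔙 𝔛 : Type*}

/-- `ℂ`-computable terms of the system with the given sort ordering. -/
def Computable (R : LCSTRS 𝔖 𝔉 𝔙 𝔛) (o : SortOrdering R.sorts) (t : PreTerm 𝔉 𝔙) : Prop := R.Comp (R.C o) t

end LCSTRS

/-- A term `f♯ t₁ ⋯ tₙ`.  All terms of the fresh sort `dp` have this form, with `t₁, …, tₙ` terms
over the original function symbols. -/
structure Marked (𝔉 𝔙 : Type*) where
  head : 𝔉
  args : List (PreTerm 𝔉 𝔙)

namespace Marked

variable {𝔉 𝔙 : Type*}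

/-- The term `f t₁ ⋯ tₙ` without the mark. -/
def unmark (m : Marked 𝔉 𝔙) : PreTerm 𝔉 𝔙 := PreTerm.apps (.fn m.head) m.args

def subst (σ : 𝔙 → PreTerm 𝔉 𝔙) (m : Marked 𝔉 𝔙) : Marked 𝔉 𝔙 :=
  ⟨m.head, m.args.map (PreTerm.subst σ)⟩

end Marked

/-- Static dependency pairs: quadruples `s♯ ⇒ t♯ [φ ∣ L]`. -/
structure SDP (𝔉 𝔙 : Type*) where
  lhs : Marked 𝔉 𝔙
  rhs : Marked 𝔉 𝔙
  constr : PreTerm 𝔉 𝔙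
  L : Set 𝔙

namespace LCSTRS

variable {𝔖 𝔉 𝔙 𝔛 : Type*}

section DependencyPairs

variable (R : LCSTRS 𝔖 𝔉 𝔙 𝔛)

/-- The rewrite relation on marked terms.  Since `f♯` is neither defined nor a theory symbol, each
step takes place inside an argument. -/
inductive MStep : Marked 𝔉 𝔙 → Marked 𝔉 𝔙 → Prop
  | arg {f : 𝔉} {ls rs : List (PreTerm 𝔉 𝔙)} {s t : PreTerm 𝔉 𝔙} : R.Step s t →
      MStep ⟨f, ls ++ s :: rs⟩ ⟨f, ls ++ t :: rs⟩

/-- The list consists of variables of the given types. -/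
def VarsOf (xs : List 𝔙) (As : List (Ty 𝔖)) : Prop :=
  List.Forall₂ (fun x A => x ∈ R.vars ∧ R.vty x = A) xs As

/-- The static dependency pairs of a rewrite rule `ℓ → r [φ]` with `ℓ = f s₁ ⋯ sₚ`, where `A` is
the type of `ℓ`, `xs` and `ys` are lists of fresh variables, and `g t₁ ⋯ t_q` is a subterm of
`r x₁ ⋯ xₘ` with `g` a defined symbol. -/
def sdpRule (ρ : Rule 𝔉 𝔙) : Set (SDP 𝔉 𝔙) :=
  {d | ∃ f ss A xs g ts ys,
    ρ.lhs = PreTerm.apps (.fn f) ss ∧ R.HasType ρ.lhs A ∧ R.VarsOf xs A.args ∧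
    (PreTerm.apps ρ.rhs (xs.map .var)).Sub (PreTerm.apps (.fn g) ts) ∧ R.IsDefined g ∧
    R.VarsOf ys ((R.fty g).args.drop ts.length) ∧
    (xs ++ ys).Nodup ∧ (∀ z ∈ xs ++ ys, z ∉ ρ.lhs.fv ∪ ρ.rhs.fv ∪ ρ.constr.fv) ∧
    d = ⟨⟨f, ss ++ xs.map .var⟩, ⟨g, ts ++ ys.map .var⟩, ρ.constr, ρ.logVars⟩}

/-- The static dependency pairs of a system. -/
def sdp : Set (SDP 𝔉 𝔙) := {d | ∃ ρ ∈ R.rules, d ∈ R.sdpRule ρ}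

/-- The substitution respects the static dependency pair. -/
def RespectsSDP (σ : 𝔙 → PreTerm 𝔉 𝔙) (d : SDP 𝔉 𝔙) : Prop :=
  (∀ x ∈ d.L, R.IsGroundTheory (σ x)) ∧ R.eval (d.constr.subst σ) [] = R.one

/-- Infinite `(P, R)`-chains. -/
structure IsInfiniteChain (P : Set (SDP 𝔉 𝔙)) (d : ℕ → SDP 𝔉 𝔙)
    (σ : ℕ → 𝔙 → PreTerm 𝔉 𝔙) : Prop where
  mem : ∀ i, d i ∈ P
  isSubst : ∀ i, R.IsSubst (σ i)
  respects : ∀ i, R.RespectsSDP (σ i) (d i)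
  step : ∀ i, Relation.ReflTransGen R.MStep ((d i).rhs.subst (σ i))
    ((d (i + 1)).lhs.subst (σ (i + 1)))

/-- The infinite chain is computable in the system with the given sort ordering. -/
def IsComputableChain (o : SortOrdering R.sorts) (d : ℕ → SDP 𝔉 𝔙)
    (σ : ℕ → 𝔙 → PreTerm 𝔉 𝔙) : Prop :=
  ∀ i u, (d i).rhs.unmark.ProperSub u → R.Computable o (u.subst (σ i))

end DependencyPairs

/-- The chain is public: the head symbol of its first dependency pair is not hidden. -/
def IsPublicChain (H : Set 𝔉) (d : ℕ → SDP 𝔉 𝔙) : Prop := (d 0).lhs.head ∉ H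

end LCSTRS

/-- Two signatures agree on everything they have in common: the types of symbols and variables, the
elements of theory sorts, the interpretations of theory symbols, and the Booleans. -/
structure Signature.Agrees {𝔖 𝔉 𝔙 𝔛 : Type*} (T T' : Signature 𝔖 𝔉 𝔙 𝔛) : Prop where
  fty : ∀ f ∈ T.funs ∩ T'.funs, T.fty f = T'.fty f
  vty : ∀ x ∈ T.vars ∩ T'.vars, T.vty x = T'.vty x
  carrier : ∀ A ∈ T.thSorts ∩ T'.thSorts, T.carrier A = T'.carrier A
  interp : ∀ f ∈ T.thFuns ∩ T'.thFuns, ∀ as : List 𝔛,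
    List.Forall₂ (fun a B => a ∈ T.carrier (Ty.target B)) as (T.fty f).args →
      T.interp f as = T'.interp f as
  bool : T.bool = T'.bool
  ff : T.ff = T'.ff
  tt : T.tt = T'.tt

namespace LCSTRS

variable {𝔖 𝔉 𝔙 𝔛 : Type*}

/-- `R₁` is an extension of the base system `R₀`. -/
structure IsExtension (R₀ R₁ : LCSTRS 𝔖 𝔉 𝔙 𝔛) : Prop where
  agrees : R₀.Agrees R₁.toSignature
  not_defined : ∀ f ∈ R₀.funs, ¬ R₁.IsDefined f

/-- `R₁` is a public extension of `R₀` with respect to the set `H` of hidden symbols. -/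
def IsPublicExtension (R₀ : LCSTRS 𝔖 𝔉 𝔙 𝔛) (H : Set 𝔉) (R₁ : LCSTRS 𝔖 𝔉 𝔙 𝔛) : Prop :=
  R₀.IsExtension R₁ ∧ ∀ ρ ∈ R₁.rules, Disjoint ρ.fns H

/-- `R` is the union of `R₀` and `R₁`.  Its variables may exceed those of `R₀` and `R₁`, because it
needs infinitely many variables also of the types that mix sorts of both. -/
structure IsUnion (R₀ R₁ R : LCSTRS 𝔖 𝔉 𝔙 𝔛) : Prop where
  sorts : R.sorts = R₀.sorts ∪ R₁.sorts
  thSorts : R.thSorts = R₀.thSorts ∪ R₁.thSorts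
  funs : R.funs = R₀.funs ∪ R₁.funs
  thFuns : R.thFuns = R₀.thFuns ∪ R₁.thFuns
  vars : R₀.vars ∪ R₁.vars ⊆ R.vars
  agrees₀ : R₀.Agrees R.toSignature
  agrees₁ : R₁.Agrees R.toSignature
  rules : R.rules = R₀.rules ∪ R₁.rules

/-- The term is universally computable: it is `ℂ`-computable in every hierarchical combination
`R = R₀ ∪ R₁` with every extension of the sort ordering. -/
def UniversallyComputableTerm (R₀ : LCSTRS 𝔖 𝔉 𝔙 𝔛) (o : SortOrdering R₀.sorts)
    (t : PreTerm 𝔉 𝔙) : Prop :=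
  ∀ R₁, R₀.IsExtension R₁ → ∀ R : LCSTRS 𝔖 𝔉 𝔙 𝔛, R₀.IsUnion R₁ R →
    ∀ o' : SortOrdering R.sorts, o'.Extends o → R.Computable o' t

/-- The term is publicly computable with respect to the set `H` of hidden symbols. -/
def PubliclyComputableTerm (R₀ : LCSTRS 𝔖 𝔉 𝔙 𝔛) (o : SortOrdering R₀.sorts) (H : Set 𝔉)
    (t : PreTerm 𝔉 𝔙) : Prop :=
  ∀ R₁, R₀.IsPublicExtension H R₁ → ∀ R : LCSTRS 𝔖 𝔉 𝔙 𝔛, R₀.IsUnion R₁ R →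
    ∀ o' : SortOrdering R.sorts, o'.Extends o → R.Computable o' t

/-- All terms of the base system are universally computable. -/
def UniversallyComputable (R₀ : LCSTRS 𝔖 𝔉 𝔙 𝔛) (o : SortOrdering R₀.sorts) : Prop :=
  ∀ t A, R₀.HasType t A → R₀.UniversallyComputableTerm o t

/-- All public terms (terms without hidden symbols) of the base system are publicly computable. -/
def PubliclyComputable (R₀ : LCSTRS 𝔖 𝔉 𝔙 𝔛) (o : SortOrdering R₀.sorts) (H : Set 𝔉) : Prop :=
  ∀ t A, R₀.HasType t A → Disjoint t.fns H → R₀.PubliclyComputableTerm o H t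

end LCSTRS

end LC

-- The proof turns a failure of computability into an infinite computable chain. Work in a
-- combination of `R₀` with an extension, and call a saturated term `f t₁ ⋯ tₙ` a minimal
-- counterexample if `f` is a symbol of `R₀`, all `tᵢ` are computable and the term itself is not.
-- Steps inside the computable arguments terminate, and calculations end in values, which are
-- computable. So after finitely many argument steps some rule `ℓ → r [φ]` applies at the head, and
-- its result is still not computable (`exists_head_step`). Extensions do not define symbols of
-- `R₀`, so this is a rule of `R₀`.
--
-- Every variable of `r` is instantiated by a computable term: by a value if it is a logical
-- variable, and otherwise because, by AFP, it is an accessible subterm of an argument of `ℓ` and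
-- accessibility preserves computability (`IsUnion.computable_of_accSub`). Hence a smallest subterm
-- of `r x₁ ⋯ xₘ` with a non-computable instance cannot have a variable as its head, nor an
-- undefined symbol, since undefined symbols are computable. It is therefore `g t₁ ⋯ t_q` with `g`
-- defined in `R₀`, and all instances of its proper subterms are computable
-- (`IsUnion.exists_minimal_subterm`). Supplying it with computable arguments that witness its
-- non-computability yields a dependency pair and the next minimal counterexample
-- (`IsMinimalNoncomputable.exists_sdp`). Iteration gives the chain.
--
-- Application preserves computability and variables are computable, so a non-computable term
-- contains a non-computable function symbol. If the term has no hidden symbol, the chain that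
-- starts at this symbol is public. The universal statement is the case of no hidden symbols.

namespace LC

variable {𝔖 𝔉 𝔙 𝔛 : Type*}

-- Applicative terms and maximally applied subterms

namespace PreTerm

theorem apps_append (h : PreTerm 𝔉 𝔙) (ss ts : List (PreTerm 𝔉 𝔙)) :
    apps h (ss ++ ts) = apps (apps h ss) ts := List.foldl_append

theorem apps_concat (h : PreTerm 𝔉 𝔙) (ss : List (PreTerm 𝔉 𝔙)) (t : PreTerm 𝔉 𝔙) :
    apps h (ss ++ [t]) = app (apps h ss) t := apps_append h ss [t]

theorem subst_apps (σ : 𝔙 → PreTerm 𝔉 𝔙) (ts : List (PreTerm 𝔉 𝔙)) (h : PreTerm 𝔉 𝔙) :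
    (apps h ts).subst σ = apps (h.subst σ) (ts.map (subst σ)) := by
  induction ts generalizing h with
  | nil => rfl
  | cons t ts ih => exact ih (app h t)

theorem fv_apps (ts : List (PreTerm 𝔉 𝔙)) (h : PreTerm 𝔉 𝔙) (x : 𝔙) :
    x ∈ (apps h ts).fv ↔ x ∈ h.fv ∨ ∃ t ∈ ts, x ∈ t.fv := by
  induction ts generalizing h with
  | nil => simp [apps]
  | cons t ts ih =>
    change x ∈ (apps (app h t) ts).fv ↔ _
    rw [ih]
    simp [fv, or_assoc]

theorem finite_fv (t : PreTerm 𝔉 𝔙) : t.fv.Finite := by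
  induction t with
  | fn f => exact Set.finite_empty
  | var x => exact Set.finite_singleton x
  | app s t hs ht => exact hs.union ht

theorem subst_congr {σ τ : 𝔙 → PreTerm 𝔉 𝔙} {t : PreTerm 𝔉 𝔙} (h : ∀ x ∈ t.fv, σ x = τ x) :
    t.subst σ = t.subst τ := by
  induction t with
  | fn f => rfl
  | var x => exact h x rfl
  | app s t hs ht =>
    simp only [subst]
    rw [hs fun x hx => h x (.inl hx), ht fun x hx => h x (.inr hx)]

theorem exists_eq_apps (t : PreTerm 𝔉 𝔙) :
    (∃ f ts, t = apps (fn f) ts) ∨ ∃ x ts, t = apps (var x) ts := by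
  induction t with
  | fn f => exact .inl ⟨f, [], rfl⟩
  | var x => exact .inr ⟨x, [], rfl⟩
  | app s t hs _ =>
    rcases hs with ⟨f, ts, rfl⟩ | ⟨x, ts, rfl⟩
    · exact .inl ⟨f, ts ++ [t], (apps_concat _ _ _).symm⟩
    · exact .inr ⟨x, ts ++ [t], (apps_concat _ _ _).symm⟩

theorem apps_fn_inj {f g : 𝔉} {ss ts : List (PreTerm 𝔉 𝔙)}
    (h : apps (fn f) ss = apps (fn g) ts) : f = g ∧ ss = ts := by
  induction ss using List.reverseRecOn generalizing ts with
  | nil =>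
    rcases List.eq_nil_or_concat' ts with rfl | ⟨ts, b, rfl⟩
    · simpa [apps] using h
    · rw [apps_concat] at h; cases h
  | append_singleton ss a ih =>
    rcases List.eq_nil_or_concat' ts with rfl | ⟨ts, b, rfl⟩
    · rw [apps_concat] at h; cases h
    · rw [apps_concat, apps_concat] at h
      injection h with h1 h2
      obtain ⟨rfl, rfl⟩ := ih h1
      exact ⟨rfl, by rw [h2]⟩

theorem sub_refl (t : PreTerm 𝔉 𝔙) : t.Sub t := by cases t <;> simp [Sub]

/-- The number of symbols of a term. -/
def size : PreTerm 𝔉 𝔙 → ℕ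
  | fn _ => 1
  | var _ => 1
  | app s t => s.size + t.size

theorem size_pos (t : PreTerm 𝔉 𝔙) : 0 < t.size := by
  induction t <;> simp_all [size]

theorem Sub.size_le {s t : PreTerm 𝔉 𝔙} (h : s.Sub t) : t.size ≤ s.size := by
  induction s with
  | fn f => cases h; exact le_rfl
  | var x => cases h; exact le_rfl
  | app s₀ s₁ h₀ h₁ =>
    rcases h with rfl | h | h
    · exact le_rfl
    · have := h₁ h; simp only [size]; omega
    · have := h₀ h.1; simp only [size]; omega

theorem ProperSub.size_lt {s t : PreTerm 𝔉 𝔙} (h : s.ProperSub t) : t.size < s.size := by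
  obtain ⟨h, hne⟩ := h
  cases s with
  | fn f => exact absurd h hne
  | var x => exact absurd h hne
  | app s₀ s₁ =>
    rcases h with rfl | h | h
    · exact absurd rfl hne
    · have := h.size_le; have := s₀.size_pos; simp only [size]; omega
    · have := h.1.size_le; have := s₁.size_pos; simp only [size]; omega

theorem Sub.trans {s t u : PreTerm 𝔉 𝔙} (h : s.Sub t) (h' : t.Sub u) : s.Sub u := by
  induction s with
  | fn f => cases h; exact h'
  | var x => cases h; exact h'
  | app s₀ s₁ h₀ h₁ =>
    rcases h with rfl | h | h
    · exact h'
    · exact .inr (.inl (h₁ h))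
    · refine .inr (.inr ⟨h₀ h.1, ?_⟩)
      -- The clause for applications excludes the head `s₀` itself; a chain of subterms from `s₀`
      -- through the smaller `t` back to `s₀` is impossible by size.
      rintro rfl
      have := ProperSub.size_lt h
      have := h'.size_le
      omega

/-- The partial applications `f t₁ ⋯ tₖ` with `k < n` are not maximally applied, so only the
arguments contribute proper subterms. This is what makes "proper subterms are computable" imply
"arguments are computable", and conversely lets a dependency pair be checked argument by argument.
-/
theorem properSub_apps_fn {f : 𝔉} {ts : List (PreTerm 𝔉 𝔙)} {u : PreTerm 𝔉 𝔙} :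
    (apps (fn f) ts).ProperSub u ↔ ∃ t ∈ ts, t.Sub u := by
  induction ts using List.reverseRecOn with
  | nil => simp [apps, ProperSub, Sub]
  | append_singleton ts a ih =>
    have key : (app (apps (fn f) ts) a).ProperSub u ↔
        a.Sub u ∨ (apps (fn f) ts).ProperSub u := by
      constructor
      · rintro ⟨h | h, hne⟩
        · exact absurd h hne
        · exact h
      · intro h
        refine ⟨.inr h, ?_⟩
        rintro rfl
        rcases h with h | h
        · have := h.size_le; have := (apps (fn f) ts).size_pos
          simp only [size] at *; omega
        · have := h.size_lt
          simp only [size] at this; omega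
    rw [apps_concat, key, ih]
    simp only [List.mem_append, List.mem_singleton]
    constructor
    · rintro (h | ⟨t, ht, h⟩)
      · exact ⟨a, .inr rfl, h⟩
      · exact ⟨t, .inl ht, h⟩
    · rintro ⟨t, ht | rfl, h⟩
      · exact .inr ⟨t, ht, h⟩
      · exact .inl h

theorem properSub_arg_var {x : 𝔙} {ts : List (PreTerm 𝔉 𝔙)} {t : PreTerm 𝔉 𝔙} (h : t ∈ ts) :
    (apps (var x) ts).ProperSub t := by
  induction ts using List.reverseRecOn with
  | nil => cases h
  | append_singleton ts a ih =>
    rw [apps_concat]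
    have hs : (app (apps (var x) ts) a).size = (apps (var x) ts).size + a.size := rfl
    rcases List.mem_append.1 h with h | h
    · have := (ih h).size_lt
      refine ⟨.inr (.inr (ih h)), ?_⟩
      rintro rfl
      omega
    · obtain rfl := List.mem_singleton.1 h
      refine ⟨.inr (.inl (sub_refl _)), fun e => ?_⟩
      have := congrArg size e
      have := (apps (var x) ts).size_pos
      omega

theorem Sub.fv_subset {s t : PreTerm 𝔉 𝔙} (h : s.Sub t) : t.fv ⊆ s.fv := by
  induction s with
  | fn f => cases h; exact le_rfl
  | var x => cases h; exact le_rfl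
  | app s₀ s₁ h₀ h₁ =>
    rcases h with rfl | h | h
    · exact le_rfl
    · exact (h₁ h).trans Set.subset_union_right
    · exact (h₀ h.1).trans Set.subset_union_left

end PreTerm

open PreTerm

-- Typing, saturation and fresh variables

namespace Signature

theorem HasType.over {T : Signature 𝔖 𝔉 𝔙 𝔛} {t : PreTerm 𝔉 𝔙} {A : Ty 𝔖}
    (h : T.HasType t A) : A.Over T.sorts := by
  induction h with
  | fn h => exact T.fty_over _ h
  | var h => exact T.vty_over _ h
  | app _ _ ih _ => exact ih.2

theorem HasType.sub {T : Signature 𝔖 𝔉 𝔙 𝔛} {s t : PreTerm 𝔉 𝔙} {A : Ty 𝔖}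
    (h : T.HasType s A) (hst : s.Sub t) : ∃ B, T.HasType t B := by
  induction h with
  | fn h => cases hst; exact ⟨_, .fn h⟩
  | var h => cases hst; exact ⟨_, .var h⟩
  | app h1 h2 ih1 ih2 =>
    rcases hst with rfl | h | h
    · exact ⟨_, .app h1 h2⟩
    · exact ih2 h
    · exact ih1 h.1

theorem HasType.mono {T T' : Signature 𝔖 𝔉 𝔙 𝔛} (hT : T.Agrees T') (hf : T.funs ⊆ T'.funs)
    (hv : T.vars ⊆ T'.vars) {t : PreTerm 𝔉 𝔙} {A : Ty 𝔖} (h : T.HasType t A) :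
    T'.HasType t A := by
  induction h with
  | fn h => rw [hT.fty _ ⟨h, hf h⟩]; exact .fn (hf h)
  | var h => rw [hT.vty _ ⟨h, hv h⟩]; exact .var (hv h)
  | app _ _ ih1 ih2 => exact .app ih1 ih2

theorem HasType.fn_inv {T : Signature 𝔖 𝔉 𝔙 𝔛} {f : 𝔉} {A : Ty 𝔖}
    (h : T.HasType (.fn f) A) : f ∈ T.funs ∧ A = T.fty f := by
  cases h with
  | fn h => exact ⟨h, rfl⟩

theorem HasType.apps {T : Signature 𝔖 𝔉 𝔙 𝔛} {ts : List (PreTerm 𝔉 𝔙)} {A : Ty 𝔖}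
    {t : PreTerm 𝔉 𝔙} (h : T.HasType t A) (hts : List.Forall₂ T.HasType ts A.args) :
    T.HasType (PreTerm.apps t ts) (.base A.target) := by
  induction A generalizing t ts with
  | base A => cases hts; exact h
  | arrow A B _ ih =>
    cases hts with
    | cons h1 h2 => exact ih (t := .app t _) (.app h h1) h2

/-- Splits the argument types of the head into those already consumed and those still expected. The
second part types the extra arguments that saturate both sides of a dependency pair. -/
theorem hasType_apps_drop {T : Signature 𝔖 𝔉 𝔙 𝔛} {ts : List (PreTerm 𝔉 𝔙)} {A B : Ty 𝔖}
    {t : PreTerm 𝔉 𝔙} (h : T.HasType (PreTerm.apps t ts) B) (ht : T.HasType t A) :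
    B.args = A.args.drop ts.length ∧ B.target = A.target ∧
      List.Forall₂ T.HasType ts (A.args.take ts.length) := by
  induction ts generalizing t A with
  | nil => obtain rfl := HasType.unique h ht; simp
  | cons s ts ih =>
    obtain ⟨As, h1, h2⟩ := hasType_apps (h := t.app s) h
    have h1' := h1
    cases h1 with
    | app h3 h4 =>
      obtain rfl := ht.unique h3
      obtain ⟨h5, h6, h7⟩ := ih h h1'
      exact ⟨h5, h6, .cons h4 h7⟩

theorem IsValue.isGroundTheory {T : Signature 𝔖 𝔉 𝔙 𝔛} {t : PreTerm 𝔉 𝔙} (h : T.IsValue t) :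
    T.IsGroundTheory t := by
  obtain ⟨f, hf, _, rfl⟩ := h
  exact ⟨⟨_, .fn (T.thFuns_sub hf)⟩, by simpa [PreTerm.fns] using hf, rfl⟩

/-- Distinct variables of given types can be chosen outside any finite set. -/
theorem exists_fresh_vars (T : Signature 𝔖 𝔉 𝔙 𝔛) (As : List (Ty 𝔖))
    (hAs : ∀ A ∈ As, A.Over T.sorts) (F : Set 𝔙) (hF : F.Finite) :
    ∃ xs : List 𝔙, List.Forall₂ (fun x A => x ∈ T.vars ∧ T.vty x = A) xs As ∧ xs.Nodup ∧
      ∀ x ∈ xs, x ∉ F := by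
  induction As generalizing F with
  | nil => exact ⟨[], .nil, .nil, by simp⟩
  | cons A As ih =>
    obtain ⟨x, hx, hxF⟩ := ((T.vars_infinite A (hAs A (by simp))).sdiff hF).nonempty
    obtain ⟨xs, h1, h2, h3⟩ := ih (fun B hB => hAs B (by simp [hB])) (insert x F) (hF.insert x)
    refine ⟨x :: xs, .cons hx h1, List.nodup_cons.2 ⟨fun h => h3 x h (by simp), h2⟩, ?_⟩
    intro y hy
    rcases List.mem_cons.1 hy with rfl | hy
    · exact hxF
    · exact fun h => h3 y hy (by simp [h])

end Signature

-- Types over a set of sorts, updates of substitutions, extended sort orderings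

theorem Ty.Over.args {S : Set 𝔖} : ∀ {A : Ty 𝔖}, A.Over S → ∀ B ∈ A.args, B.Over S
  | .base _, _, _, h => by cases h
  | .arrow A B, h, C, hC => by
      rcases List.mem_cons.1 hC with rfl | hC
      · exact h.1
      · exact Ty.Over.args h.2 C hC

theorem Ty.Over.target {S : Set 𝔖} : ∀ {A : Ty 𝔖}, A.Over S → A.target ∈ S
  | .base _, h => h
  | .arrow _ B, h => Ty.Over.target (A := B) h.2

/-- A substitution can be changed on a list of distinct variables. -/
theorem exists_subst_update {α β : Type*} {P : α → β → Prop} (σ : α → β) {xs : List α}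
    {vs : List β} (h : List.Forall₂ P xs vs) (hxs : xs.Nodup) :
    ∃ τ : α → β, xs.map τ = vs ∧ (∀ x ∈ xs, P x (τ x)) ∧ ∀ x ∉ xs, τ x = σ x := by
  classical
  induction h with
  | nil => exact ⟨σ, rfl, by simp, fun _ _ => rfl⟩
  | @cons x v xs vs hxv h ih =>
    obtain ⟨hx, hxs⟩ := List.nodup_cons.1 hxs
    obtain ⟨τ, h1, h2, h3⟩ := ih hxs
    have hτ : ∀ y ∈ xs, Function.update τ x v y = τ y := fun y hy =>
      Function.update_of_ne (by rintro rfl; exact hx hy) _ _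
    refine ⟨Function.update τ x v, ?_, ?_, ?_⟩
    · rw [List.map_cons, Function.update_self, List.map_congr_left hτ, h1]
    · intro y hy
      rcases List.mem_cons.1 hy with rfl | hy
      · rwa [Function.update_self]
      · rw [hτ y hy]; exact h2 y hy
    · intro y hy
      rw [List.mem_cons, not_or] at hy
      rw [Function.update_of_ne hy.1]; exact h3 y hy.2

namespace SortOrdering

/-- Both relations compare `A` only with sorts that occur in the type, and on these the two
orderings coincide. Hence accessible positions of base symbols survive in the combination. -/
theorem Extends.pos_neg {S S' : Set 𝔖} {o : SortOrdering S} {o' : SortOrdering S'}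
    (h : o'.Extends o) {A : 𝔖} (hA : A ∈ S) : ∀ {T : Ty 𝔖}, T.Over S →
      ((o'.Pos A T ↔ o.Pos A T) ∧ (o'.Neg A T ↔ o.Neg A T))
  | .base C, hC => by
      simp only [Pos, Neg, gt]
      rw [h A hA C hC, h C hC A hA]
      exact ⟨Iff.rfl, Iff.rfl⟩
  | .arrow T U, hT => by
      have h1 := Extends.pos_neg h hA hT.1
      have h2 := Extends.pos_neg h hA hT.2
      simp only [Pos, Neg, h1, h2, and_self]

end SortOrdering

namespace LCSTRS

-- Rewrite steps and computability for an arbitrary set of reducibility candidates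

section Closure

variable {R : LCSTRS 𝔖 𝔉 𝔙 𝔛}

theorem Step.apps {s t : PreTerm 𝔉 𝔙} (h : R.Step s t) (ts : List (PreTerm 𝔉 𝔙)) :
    R.Step (PreTerm.apps s ts) (PreTerm.apps t ts) := by
  induction ts generalizing s t with
  | nil => exact h
  | cons u ts ih => exact ih (s := s.app u) (.appL h)

theorem Step.apps_arg {s t : PreTerm 𝔉 𝔙} (h : R.Step s t) (u : PreTerm 𝔉 𝔙)
    (ls rs : List (PreTerm 𝔉 𝔙)) :
    R.Step (PreTerm.apps u (ls ++ s :: rs)) (PreTerm.apps u (ls ++ t :: rs)) := by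
  rw [apps_append, apps_append]
  exact Step.apps (s := .app _ s) (.appR h) rs

/-- A reduction step from a term with a function symbol as its head takes place in an argument or
is a rule application or calculation at its head. -/
theorem Step.apps_fn_inv {f : 𝔉} {ts : List (PreTerm 𝔉 𝔙)} {t' : PreTerm 𝔉 𝔙}
    (h : R.Step (PreTerm.apps (.fn f) ts) t') :
    (∃ ts', t' = PreTerm.apps (.fn f) ts' ∧ R.MStep ⟨f, ts⟩ ⟨f, ts'⟩) ∨
    (∃ ρ ∈ R.rules, ∃ σ ss rest, R.IsSubst σ ∧ R.RespectsRule σ ρ ∧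
      ρ.lhs = PreTerm.apps (.fn f) ss ∧ ts = ss.map (subst σ) ++ rest ∧
      t' = PreTerm.apps (ρ.rhs.subst σ) rest) ∨
    ∃ v rest, R.IsValue v ∧ t' = PreTerm.apps v rest := by
  generalize hs : PreTerm.apps (.fn f) ts = s at h
  induction h generalizing ts with
  | @rule ρ σ hρ hσ hr =>
    obtain ⟨g, ss, hss⟩ := (R.rules_valid ρ hρ).head
    rw [hss, subst_apps] at hs
    obtain ⟨rfl, rfl⟩ := apps_fn_inj hs
    exact .inr (.inl ⟨ρ, hρ, σ, ss, [], hσ, hr, hss, by simp, rfl⟩)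
  | calculation _ _ _ hv => exact .inr (.inr ⟨_, [], hv, rfl⟩)
  | @appL s s' t hst ih =>
    rcases List.eq_nil_or_concat' ts with rfl | ⟨ts, b, rfl⟩
    · cases hs
    · rw [apps_concat] at hs
      injection hs with h1 h2
      subst h2
      rcases ih h1 with ⟨ts', rfl, h⟩ | ⟨ρ, hρ, σ, ss, rest, hσ, hr, h3, rfl, rfl⟩ |
        ⟨v, rest, hv, rfl⟩
      · refine .inl ⟨ts' ++ [b], (apps_concat _ _ _).symm, ?_⟩
        cases h with
        | arg h => simpa using MStep.arg (rs := _ ++ [b]) h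
      · exact .inr (.inl ⟨ρ, hρ, σ, ss, rest ++ [b], hσ, hr, h3, by simp,
          (apps_concat _ _ _).symm⟩)
      · exact .inr (.inr ⟨v, rest ++ [b], hv, (apps_concat _ _ _).symm⟩)
  | @appR s t t' hst ih =>
    rcases List.eq_nil_or_concat' ts with rfl | ⟨ts, b, rfl⟩
    · cases hs
    · rw [apps_concat] at hs
      injection hs with h1 h2
      subst h1 h2
      exact .inl ⟨ts ++ [t'], (apps_concat _ _ _).symm, MStep.arg (rs := []) hst⟩

theorem _root_.LC.PreTerm.IsNeutral.app {s : PreTerm 𝔉 𝔙} (h : s.IsNeutral) (t : PreTerm 𝔉 𝔙) :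
    (s.app t).IsNeutral := by
  obtain ⟨x, ts, rfl⟩ := h
  exact ⟨x, ts ++ [t], (apps_concat _ _ _).symm⟩

/-- A reduction step from a neutral application takes place in one of the two components. -/
theorem Step.app_neutral_inv {s t u : PreTerm 𝔉 𝔙} (h : s.IsNeutral) (hu : R.Step (s.app t) u) :
    (∃ s', R.Step s s' ∧ u = s'.app t) ∨ ∃ t', R.Step t t' ∧ u = s.app t' := by
  generalize e : s.app t = r at hu
  cases hu with
  | @rule ρ σ hρ hσ hr =>
    obtain ⟨g, ss, hss⟩ := (R.rules_valid ρ hρ).head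
    have hn := h.app t
    rw [e, hss, subst_apps] at hn
    exact absurd hn not_neutral_fn
  | calculation =>
    have hn := h.app t
    rw [e] at hn
    exact absurd hn not_neutral_fn
  | appL h => injection e with h1 h2; subst h1 h2; exact .inl ⟨_, h, rfl⟩
  | appR h => injection e with h1 h2; subst h1 h2; exact .inr ⟨_, h, rfl⟩

theorem not_step_var {x : 𝔙} {t : PreTerm 𝔉 𝔙} : ¬ R.Step (.var x) t := by
  intro h
  generalize e : PreTerm.var x = r at h
  cases h with
  | @rule ρ σ hρ hσ hr =>
    obtain ⟨g, ss, hss⟩ := (R.rules_valid ρ hρ).head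
    rw [hss, subst_apps] at e
    exact not_neutral_fn ⟨x, [], e.symm⟩
  | calculation => exact not_neutral_fn ⟨x, [], e.symm⟩
  | appL => cases e
  | appR => cases e

/-- An infinite sequence from `t` would be carried by `F` to one from `F t`. -/
theorem Terminating.of_map {r : PreTerm 𝔉 𝔙 → PreTerm 𝔉 𝔙 → Prop}
    (F : PreTerm 𝔉 𝔙 → PreTerm 𝔉 𝔙) (hF : ∀ s t, r s t → r (F s) (F t)) {t : PreTerm 𝔉 𝔙}
    (h : Terminating r (F t)) : Terminating r t := by
  unfold Terminating at *
  generalize e : F t = u at h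
  induction h generalizing t with
  | intro u _ ih =>
    subst e
    exact ⟨_, fun s hs => ih _ (hF _ _ hs) rfl⟩

variable {I : 𝔖 → Set (PreTerm 𝔉 𝔙)}

theorem Comp.at {t : PreTerm 𝔉 𝔙} (hc : R.Comp I t) {A : Ty 𝔖} (ht : R.HasType t A) : R.CompAt I A t := by
  obtain ⟨B, hB⟩ := hc
  obtain rfl := hB.hasType.unique ht
  exact hB

theorem CompAt.step (hI : R.IsRC I) {A : Ty 𝔖} {s t : PreTerm 𝔉 𝔙} (hs : R.CompAt I A s)
    (h : R.Step s t) : R.CompAt I A t := by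
  induction A generalizing s t with
  | base A => exact ⟨h.hasType hs.1, hI.closed _ _ hs.2 _ h⟩
  | arrow A B _ ih => exact ⟨h.hasType hs.1, fun u hu => ih (hs.2 u hu) (.appL h)⟩

/-- Computable terms terminate, and neutral terms are computable if all their reducts are. -/
theorem CompAt.terminating_and_neutral (hI : R.IsRC I) (A : Ty 𝔖) :
    (∀ t, R.CompAt I A t → Terminating R.Step t) ∧
    ∀ s, R.HasType s A → s.IsNeutral → (∀ t, R.Step s t → R.CompAt I A t) → R.CompAt I A s := by
  induction A with
  | base A =>
    exact ⟨fun t ht => (hI.terminating _ _ ht.2).2,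
      fun s hs hn h => ⟨hs, hI.neutral _ _ hs hn fun t ht => (h t ht).2⟩⟩
  | arrow A B ihA ihB =>
    refine ⟨fun t ht => ?_, fun s hs hn h => ⟨hs, fun u hu => ?_⟩⟩
    -- The neutral half of the induction hypothesis makes a variable computable at `A`, so `t x`
    -- terminates by the hypothesis at `B`; steps of `t` lift to `t x`.
    · obtain ⟨x, hx, rfl⟩ := (R.vars_infinite A ht.1.over.1).nonempty
      have hc : R.CompAt I (R.vty x) (.var x) :=
        ihA.2 _ (.var hx) ⟨x, [], rfl⟩ fun t h => absurd h not_step_var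
      exact (ihB.1 _ (ht.2 _ hc)).of_map (fun s => .app s (.var x)) fun _ _ h => .appL h
    -- Induction on the termination of `u`: the reducts of the neutral term `s u` change either `s`,
    -- covered by the assumption, or `u`, covered by this induction.
    · have hu' := ihA.1 u hu
      unfold Terminating at hu'
      induction hu' with
      | intro u _ ih =>
        refine ihB.2 _ (.app hs hu.hasType) (hn.app u) fun t ht => ?_
        rcases ht.app_neutral_inv hn with ⟨s', h1, rfl⟩ | ⟨u', h1, rfl⟩
        · exact (h s' h1).2 u hu
        · exact ih u' h1 (hu.step hI h1)

theorem CompAt.terminating (hI : R.IsRC I) {A : Ty 𝔖} {t : PreTerm 𝔉 𝔙} (h : R.CompAt I A t) :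
    Terminating R.Step t := (terminating_and_neutral hI A).1 t h

theorem CompAt.var (hI : R.IsRC I) {x : 𝔙} (hx : x ∈ R.vars) :
    R.CompAt I (R.vty x) (.var x) :=
  (terminating_and_neutral hI _).2 _ (.var hx) ⟨x, [], rfl⟩ fun _ h => absurd h not_step_var

theorem CompAt.apps {A : Ty 𝔖} {t : PreTerm 𝔉 𝔙} {ts : List (PreTerm 𝔉 𝔙)}
    (h : R.CompAt I A t) (hts : List.Forall₂ (R.CompAt I) A.args ts) :
    R.CompAt I (.base A.target) (PreTerm.apps t ts) := by
  induction A generalizing t ts with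
  | base A => cases hts; exact h
  | arrow A B _ ih =>
    cases hts with
    | cons h1 h2 => exact ih (t := t.app _) (h.2 _ h1) h2

/-- Unfolds computability at all arrows at once, so that computability at a higher type is tested
only on saturated terms of base type. -/
theorem CompAt.of_apps {A : Ty 𝔖} {t : PreTerm 𝔉 𝔙} (ht : R.HasType t A)
    (h : ∀ ts, List.Forall₂ (R.CompAt I) A.args ts → PreTerm.apps t ts ∈ I A.target) :
    R.CompAt I A t := by
  induction A generalizing t with
  | base A => exact ⟨ht, h [] .nil⟩
  | arrow A B _ ih =>
    exact ⟨ht, fun u hu => ih (.app ht hu.hasType) fun ts hts => h (u :: ts) (.cons hu hts)⟩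

theorem Comp.app {s t : PreTerm 𝔉 𝔙} {A : Ty 𝔖} (h : R.HasType (.app s t) A) (hs : R.Comp I s)
    (ht : R.Comp I t) : R.CompAt I A (.app s t) := by
  cases h with
  | app h1 h2 => exact (hs.at h1).2 _ (ht.at h2)

theorem Comp.apps {t : PreTerm 𝔉 𝔙} {ts : List (PreTerm 𝔉 𝔙)} {A : Ty 𝔖}
    (h : R.HasType (PreTerm.apps t ts) A) (ht : R.Comp I t) (hts : ∀ u ∈ ts, R.Comp I u) :
    R.CompAt I A (PreTerm.apps t ts) := by
  induction ts using List.reverseRecOn generalizing A with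
  | nil => exact ht.at h
  | append_singleton ts a ih =>
    rw [apps_concat] at h ⊢
    cases h with
    | app h1 h2 =>
      exact (ih h1 fun u hu => hts u (by simp [hu])).2 _ ((hts a (by simp)).at h2)

/-- There are computable arguments for each type, namely variables. -/
theorem exists_compAt_args (hI : R.IsRC I) (As : List (Ty 𝔖)) (hAs : ∀ A ∈ As, A.Over R.sorts) :
    ∃ ts, List.Forall₂ (R.CompAt I) As ts := by
  induction As with
  | nil => exact ⟨[], .nil⟩
  | cons A As ih =>
    obtain ⟨ts, hts⟩ := ih fun B hB => hAs B (by simp [hB])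
    obtain ⟨x, hx, rfl⟩ := (R.vars_infinite A (hAs A (by simp))).nonempty
    exact ⟨.var x :: ts, .cons (.var hI hx) hts⟩

theorem MStep.compAt (hI : R.IsRC I) {f : 𝔉} {As : List (Ty 𝔖)} {ts ts' : List (PreTerm 𝔉 𝔙)}
    (hts : List.Forall₂ (R.CompAt I) As ts) (h : R.MStep ⟨f, ts⟩ ⟨f, ts'⟩) :
    List.Forall₂ (R.CompAt I) As ts' := by
  cases h with
  | @arg _ ls rs s t h =>
    induction ls generalizing As with
    | nil =>
      cases hts with
      | cons h1 h2 => exact .cons (h1.step hI h) h2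
    | cons l ls ih =>
      cases hts with
      | cons h1 h2 => exact .cons h1 (ih h2)

end Closure

-- Computability with respect to `ℂ`

section Candidates

variable {R : LCSTRS 𝔖 𝔉 𝔙 𝔛} {o : SortOrdering R.sorts}

theorem comp_of_forall₂ {I : 𝔖 → Set (PreTerm 𝔉 𝔙)} {As : List (Ty 𝔖)}
    {ts : List (PreTerm 𝔉 𝔙)} (h : List.Forall₂ (R.CompAt I) As ts) :
    ∀ t ∈ ts, R.Comp I t := by
  induction h with
  | nil => simp
  | cons h1 _ ih =>
    intro t ht
    rcases List.mem_cons.1 ht with rfl | ht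
    · exact ⟨_, h1⟩
    · exact ih t ht

/-- The analogue of the neutral-term property for a function symbol as head. A `⇛`-step leads to an
argument applied to computable terms, which is computable because the argument is; so it adds no
infinite sequence. The condition on accessible arguments holds for the term itself by assumption and
for later reducts through the first step. -/
theorem mem_C_of_reducts {f : 𝔉} {ts : List (PreTerm 𝔉 𝔙)} {A : 𝔖}
    (h : R.HasType (PreTerm.apps (.fn f) ts) (.base A)) (hts : ∀ t ∈ ts, R.Comp (R.C o) t)
    (hr : ∀ t, R.Step (PreTerm.apps (.fn f) ts) t → t ∈ R.C o A) :
    PreTerm.apps (.fn f) ts ∈ R.C o A := by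
  rw [C_eq]
  refine ⟨h, ⟨_, fun t ht => ?_⟩, fun t' ht' g us e k u hk hu => ?_⟩
  · rcases ht with ht | ⟨_, ⟨B, hB⟩, g, ss, k, u, ws, e, hk, hu, rfl, hw⟩
    · have := hr t ht
      rw [C_eq] at this
      exact this.2.1
    · obtain ⟨rfl, rfl⟩ := apps_fn_inj e
      have := (Comp.apps hB (hts u (List.mem_of_getElem? hu)) hw).2
      rw [C_eq] at this
      exact this.2.1
  · rcases Relation.ReflTransGen.cases_head ht' with rfl | ⟨t, h1, h2⟩
    · obtain ⟨rfl, rfl⟩ := apps_fn_inj e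
      exact hts u (List.mem_of_getElem? hu)
    · have := hr t h1
      rw [C_eq] at this
      exact this.2.2 t' h2 g us e k u hk hu

theorem forall₂_hasType {I : 𝔖 → Set (PreTerm 𝔉 𝔙)} {As : List (Ty 𝔖)}
    {ts : List (PreTerm 𝔉 𝔙)} (h : List.Forall₂ (R.CompAt I) As ts) :
    List.Forall₂ R.HasType ts As := (h.imp fun _ _ h => h.hasType).flip

/-- A left-hand side contains a symbol outside the theory, and calculations need at least one
argument. -/
theorem not_step_value {v t : PreTerm 𝔉 𝔙} (hv : R.IsValue v) : ¬ R.Step v t := by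
  obtain ⟨f, hf, ⟨A, hA⟩, rfl⟩ := hv
  intro h
  generalize e : PreTerm.fn f = r at h
  cases h with
  | @rule ρ σ hρ hσ hr =>
    obtain ⟨g, ss, hss⟩ := (R.rules_valid ρ hρ).head
    rw [hss, subst_apps] at e
    obtain ⟨rfl, h2⟩ := apps_fn_inj (ss := []) e
    obtain rfl := List.map_eq_nil_iff.1 h2.symm
    obtain ⟨g, hg, hg'⟩ := (R.rules_valid ρ hρ).not_theory
    rw [hss] at hg
    cases hg
    exact hg' hf
  | calculation _ hne =>
    exact hne (apps_fn_inj (ss := []) e).2.symm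
  | appL => cases e
  | appR => cases e

theorem IsValue.computable {v : PreTerm 𝔉 𝔙} (hv : R.IsValue v) : R.Computable o v := by
  have hv' := hv
  obtain ⟨f, hf, ⟨A, hA⟩, rfl⟩ := hv'
  have ht : R.HasType (.fn f) (.base A) := hA ▸ .fn (R.thFuns_sub hf)
  exact ⟨.base A, ht, mem_C_of_reducts (ts := []) ht (by simp) fun t h =>
    absurd h (not_step_value hv)⟩

/-- If `f t₁ ⋯ tₙ` is not computable though all `tᵢ` are, then after some reduction steps inside
the arguments a rule can be applied at the head, with a result that is not computable. -/
theorem exists_head_step {f : 𝔉} (hf : f ∈ R.funs) {ts : List (PreTerm 𝔉 𝔙)}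
    (hts : List.Forall₂ (R.CompAt (R.C o)) (R.fty f).args ts)
    (hn : PreTerm.apps (.fn f) ts ∉ R.C o (R.fty f).target) :
    ∃ ρ ∈ R.rules, ∃ σ ss rest, R.IsSubst σ ∧ R.RespectsRule σ ρ ∧
      ρ.lhs = PreTerm.apps (.fn f) ss ∧
      Relation.ReflTransGen R.MStep ⟨f, ts⟩ ⟨f, ss.map (subst σ) ++ rest⟩ ∧
      List.Forall₂ (R.CompAt (R.C o)) (R.fty f).args (ss.map (subst σ) ++ rest) ∧
      PreTerm.apps (ρ.rhs.subst σ) rest ∉ R.C o (R.fty f).target := by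
  -- A variable `x` of the type of `f` gives a joint termination measure for the arguments: `x t₁ ⋯
  -- tₙ` is computable, hence terminates, and it follows every argument step of `f t₁ ⋯ tₙ`.
  obtain ⟨x, hx, hxf⟩ := (R.vars_infinite _ (R.fty_over f hf)).nonempty
  have hI := R.C_isRC o
  have hT : Terminating R.Step (PreTerm.apps (.var x) ts) :=
    (CompAt.apps (CompAt.var hI hx) (hxf ▸ hts)).terminating hI
  unfold Terminating at hT
  generalize e : PreTerm.apps (.var x) ts = u at hT
  induction hT generalizing ts with
  | intro u _ ih =>
    subst e
    have ht : R.HasType (PreTerm.apps (.fn f) ts) (.base (R.fty f).target) :=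
      Signature.HasType.apps (.fn hf) (forall₂_hasType hts)
    have : ∃ t, R.Step (PreTerm.apps (.fn f) ts) t ∧ t ∉ R.C o (R.fty f).target := by
      by_contra! h
      exact hn (mem_C_of_reducts ht (comp_of_forall₂ hts) h)
    obtain ⟨t, hst, hnt⟩ := this
    rcases hst.apps_fn_inv with ⟨ts', rfl, h⟩ | ⟨ρ, hρ, σ, ss, rest, hσ, hr, h3, rfl, rfl⟩ |
      ⟨v, rest, hv, rfl⟩
    · have hxs : R.Step (PreTerm.apps (.var x) ts) (PreTerm.apps (.var x) ts') := by
        cases h with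
        | arg h => exact h.apps_arg _ _ _
      obtain ⟨ρ, hρ, σ, ss, rest, hσ, hr, h3, h4, h5⟩ := ih _ hxs (h.compAt hI hts) hnt rfl
      exact ⟨ρ, hρ, σ, ss, rest, hσ, hr, h3, .head h h4, h5⟩
    · exact ⟨ρ, hρ, σ, ss, rest, hσ, hr, h3, .refl, hts, hnt⟩
    -- A value has a sort as its type, so no arguments are left over and the result of the
    -- calculation is a computable value.
    · obtain ⟨g, hg, ⟨A, hA⟩, rfl⟩ := id hv
      obtain ⟨h1, _, h2⟩ := Signature.hasType_apps_drop (hst.hasType ht) (.fn (R.thFuns_sub hg))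
      rw [hA] at h2
      simp only [Ty.args, List.take_nil] at h2
      obtain rfl := List.forall₂_nil_right_iff.1 h2
      exact absurd ((IsValue.computable hv).at (hst.hasType ht)).2 hnt

/-- A failure would force a rule application at the head. This includes theory symbols, whose
calculations yield only values. -/
theorem computable_fn_of_not_defined {f : 𝔉} (hf : f ∈ R.funs) (h : ¬ R.IsDefined f) :
    R.CompAt (R.C o) (R.fty f) (.fn f) := by
  refine CompAt.of_apps (.fn hf) fun ts hts => ?_
  by_contra hn
  obtain ⟨ρ, hρ, _, ss, _, _, _, h3, _⟩ := exists_head_step hf hts hn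
  exact h ⟨ρ, hρ, ss, h3⟩

/-- Accessible arguments of computable terms are computable. -/
theorem Computable.of_accPos {f : 𝔉} {ss : List (PreTerm 𝔉 𝔙)} {k : ℕ} {u : PreTerm 𝔉 𝔙}
    (h : R.Computable o (PreTerm.apps (.fn f) ss)) (hk : R.AccPos o f k)
    (hu : ss[k]? = some u) : R.Computable o u := by
  obtain ⟨A, hA⟩ := h
  -- The equation for `ℂ` speaks of base types only, so the term is first saturated with computable
  -- arguments; these come after position `k`.
  obtain ⟨ts, hts⟩ := exists_compAt_args (R.C_isRC o) A.args hA.hasType.over.args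
  have := (hA.apps hts).2
  rw [← apps_append, C_eq] at this
  exact this.2.2 _ .refl f _ rfl k u hk (by
    rw [List.getElem?_append_left (List.getElem?_eq_some_iff.1 hu).1]; exact hu)

end Candidates

end LCSTRS

namespace LCSTRS

-- Hierarchical combinations: from non-computable terms to chains

section Combination

variable {R₀ R₁ R : LCSTRS 𝔖 𝔉 𝔙 𝔛} {o : SortOrdering R₀.sorts} {o' : SortOrdering R.sorts}

theorem IsUnion.hasType (hU : R₀.IsUnion R₁ R) {t : PreTerm 𝔉 𝔙} {A : Ty 𝔖}
    (h : R₀.HasType t A) : R.HasType t A :=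
  h.mono hU.agrees₀ (by rw [hU.funs]; exact Set.subset_union_left)
    (Set.subset_union_left.trans hU.vars)

theorem IsUnion.accPos (hU : R₀.IsUnion R₁ R) (ho : o'.Extends o) {f : 𝔉} (hf : f ∈ R₀.funs)
    {k : ℕ} (h : R₀.AccPos o f k) : R.AccPos o' f k := by
  obtain ⟨B, hB, hP⟩ := h
  have hov := R₀.fty_over f hf
  unfold AccPos
  rw [← hU.agrees₀.fty f ⟨hf, by rw [hU.funs]; exact .inl hf⟩]
  exact ⟨B, hB, (ho.pos_neg hov.target (hov.args B (List.mem_of_getElem? hB))).1.2 hP⟩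

/-- Each accessible position of `R₀` is accessible in the combination, and accessible arguments
inherit computability. This is how AFP makes the non-logical variables of a rule computable. -/
theorem IsUnion.computable_of_accSub (hU : R₀.IsUnion R₁ R) (ho : o'.Extends o)
    {s t : PreTerm 𝔉 𝔙} (h : R₀.AccSub o s t) {σ : 𝔙 → PreTerm 𝔉 𝔙}
    (hs : R.Computable o' (s.subst σ)) : R.Computable o' (t.subst σ) := by
  induction h with
  | refl => exact hs
  | arg hf hk hu _ ih =>
    rw [subst_apps] at hs
    exact ih (hs.of_accPos (hU.accPos ho hf hk) (by simp [hu]))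

theorem IsUnion.isDefined (hU : R₀.IsUnion R₁ R) (hE : R₀.IsExtension R₁) {f : 𝔉}
    (hf : f ∈ R₀.funs) {ρ : Rule 𝔉 𝔙} (hρ : ρ ∈ R.rules) (h : ρ.Defines f) : ρ ∈ R₀.rules := by
  rw [hU.rules] at hρ
  exact hρ.resolve_right fun h1 => hE.not_defined f hf ⟨ρ, h1, h⟩

/-- The two alternatives match the two sources of computability: instantiation by values, and
accessibility from AFP. -/
theorem _root_.LC.Rule.mem_logVars_or (ρ : Rule 𝔉 𝔙) {x : 𝔙} (hx : x ∈ ρ.rhs.fv) :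
    x ∈ ρ.logVars ∨ x ∈ (ρ.lhs.fv ∩ ρ.rhs.fv) \ ρ.constr.fv := by
  unfold Rule.logVars
  by_cases h1 : x ∈ ρ.constr.fv
  · exact .inl (.inl h1)
  · by_cases h2 : x ∈ ρ.lhs.fv
    · exact .inr ⟨⟨h2, hx⟩, h1⟩
    · exact .inl (.inr ⟨hx, h2⟩)

/-- A substitution that makes a term of the base system not computable, although it maps all
variables of the term to computable terms, makes a subterm with a defined head not computable all
of whose own proper subterms become computable. -/
theorem IsUnion.exists_minimal_subterm (hU : R₀.IsUnion R₁ R) (hE : R₀.IsExtension R₁)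
    {u : PreTerm 𝔉 𝔙} {A : Ty 𝔖} (hu : R₀.HasType u A) {τ : 𝔙 → PreTerm 𝔉 𝔙}
    (hτ : R.IsSubst τ) (hx : ∀ x ∈ u.fv, R.Computable o' (τ x))
    (hn : ¬ R.Computable o' (u.subst τ)) :
    ∃ g ts, u.Sub (PreTerm.apps (.fn g) ts) ∧ R₀.IsDefined g ∧
      ¬ R.Computable o' ((PreTerm.apps (.fn g) ts).subst τ) ∧
      ∀ w, (PreTerm.apps (.fn g) ts).ProperSub w → R.Computable o' (w.subst τ) := by
  obtain ⟨v, ⟨huv, hv⟩, hmin⟩ := WellFounded.has_min (measure (size (𝔉 := 𝔉) (𝔙 := 𝔙))).wf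
    {w | u.Sub w ∧ ¬ R.Computable o' (w.subst τ)} ⟨u, sub_refl u, hn⟩
  have hP : ∀ w, v.ProperSub w → R.Computable o' (w.subst τ) := by
    intro w hw
    by_contra h
    exact hmin w ⟨huv.trans hw.1, h⟩ hw.size_lt
  obtain ⟨B, hB⟩ := hu.sub huv
  have hB' := (hU.hasType hB).subst hτ
  rcases exists_eq_apps v with ⟨g, ts, rfl⟩ | ⟨x, ts, rfl⟩
  · refine ⟨g, ts, huv, ?_, hv, hP⟩
    -- An undefined head is computable, and so are the arguments by minimality; then their
    -- application would be computable. A base symbol undefined in `R₀` stays undefined in the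
    -- combination.
    by_contra hg
    obtain ⟨As, hgt, _⟩ := Signature.hasType_apps hB
    have hg₀ := hgt.fn_inv.1
    have hgR : g ∈ R.funs := by rw [hU.funs]; exact .inl hg₀
    have hd : ¬ R.IsDefined g := fun ⟨ρ, hρ, h⟩ => hg ⟨ρ, hU.isDefined hE hg₀ hρ h, h⟩
    rw [subst_apps] at hv hB'
    refine hv ⟨_, Comp.apps hB' ⟨_, computable_fn_of_not_defined hgR hd⟩ ?_⟩
    simp only [List.mem_map]
    rintro _ ⟨t, ht, rfl⟩
    exact hP t (properSub_apps_fn.2 ⟨t, ht, sub_refl t⟩)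
  · rw [subst_apps] at hv hB'
    refine absurd ⟨_, Comp.apps hB' (hx x (huv.fv_subset ((fv_apps _ _ _).2 (.inl rfl)))) ?_⟩ hv
    simp only [List.mem_map]
    rintro _ ⟨t, ht, rfl⟩
    exact hP t (properSub_arg_var ht)

/-- The marked term is a minimal term that is not computable: its head is a function symbol of the
base system, its arguments are computable, and without the mark it is not computable. -/
structure IsMinimalNoncomputable (R₀ R : LCSTRS 𝔖 𝔉 𝔙 𝔛) (o' : SortOrdering R.sorts)
    (m : Marked 𝔉 𝔙) : Prop where
  head : m.head ∈ R₀.funs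
  args : List.Forall₂ (R.CompAt (R.C o')) (R.fty m.head).args m.args
  not_mem : m.unmark ∉ R.C o' (R.fty m.head).target

/-- Non-computability at an arrow type is witnessed by computable arguments for which the saturated
application leaves `ℂ`; appending them gives the minimal term. -/
theorem exists_minimalNoncomputable {f : 𝔉} {ts : List (PreTerm 𝔉 𝔙)} (hf : f ∈ R₀.funs)
    {A : Ty 𝔖} (hA : R.HasType (PreTerm.apps (.fn f) ts) A) (hts : ∀ t ∈ ts, R.Computable o' t)
    (h : ¬ R.Computable o' (PreTerm.apps (.fn f) ts)) :
    ∃ vs, List.Forall₂ (R.CompAt (R.C o')) ((R.fty f).args.drop ts.length) vs ∧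
      IsMinimalNoncomputable R₀ R o' ⟨f, ts ++ vs⟩ := by
  obtain ⟨As, hfA, _⟩ := Signature.hasType_apps hA
  obtain ⟨hfR, e⟩ := hfA.fn_inv
  obtain ⟨h1, h2, h3⟩ := Signature.hasType_apps_drop hA (.fn hfR)
  have : ∃ vs, List.Forall₂ (R.CompAt (R.C o')) A.args vs ∧
      PreTerm.apps (PreTerm.apps (.fn f) ts) vs ∉ R.C o' A.target := by
    by_contra! hc
    exact h ⟨A, CompAt.of_apps hA hc⟩
  obtain ⟨vs, hvs, hn⟩ := this
  rw [h1] at hvs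
  refine ⟨vs, hvs, hf, ?_, ?_⟩
  · have hts' : List.Forall₂ (R.CompAt (R.C o')) ((R.fty f).args.take ts.length) ts := by
      rw [List.forall₂_iff_get] at h3 ⊢
      exact ⟨h3.1.symm, fun i hi hi' =>
        (hts _ (List.get_mem _ _)).at (h3.2 i hi' hi)⟩
    have := List.rel_append hts' hvs
    beta_reduce at this
    rwa [List.take_append_drop] at this
  · rw [← h2]
    simpa [Marked.unmark, apps_append] using hn

/-- Each minimal term that is not computable leads to another one by a dependency pair. -/
theorem IsMinimalNoncomputable.exists_sdp (hAFP : R₀.IsAFP o) (hU : R₀.IsUnion R₁ R)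
    (hE : R₀.IsExtension R₁) (ho : o'.Extends o) {m : Marked 𝔉 𝔙}
    (hm : IsMinimalNoncomputable R₀ R o' m) :
    ∃ d ∈ R₀.sdp, ∃ τ, R.IsSubst τ ∧ R.RespectsSDP τ d ∧ d.lhs.head = m.head ∧
      Relation.ReflTransGen R.MStep m (d.lhs.subst τ) ∧
      (∀ u, d.rhs.unmark.ProperSub u → R.Computable o' (u.subst τ)) ∧
      IsMinimalNoncomputable R₀ R o' (d.rhs.subst τ) := by
  obtain ⟨f, ts₀⟩ := m
  obtain ⟨hf, hts, hn⟩ := hm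
  dsimp only at hf hts hn
  have hfR : f ∈ R.funs := by rw [hU.funs]; exact .inl hf
  obtain ⟨ρ, hρR, σ, ss, rest, hσ, hr, hlhs, hsteps, hargs, hnr⟩ := exists_head_step hfR hts hn
  have hρ : ρ ∈ R₀.rules := hU.isDefined hE hf hρR ⟨ss, hlhs⟩
  obtain ⟨A, hA1, hA2⟩ := (R₀.rules_valid ρ hρ).same_type
  have hA1' := hA1
  rw [hlhs] at hA1'
  obtain ⟨hAargs, hAtgt, _⟩ := Signature.hasType_apps_drop hA1' (.fn hf)
  rw [hU.agrees₀.fty f ⟨hf, hfR⟩] at hAargs hAtgt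
  have hrest : List.Forall₂ (R.CompAt (R.C o')) A.args rest := by
    have := List.forall₂_drop ss.length hargs
    rw [← hAargs, List.drop_left' (by simp)] at this
    exact this
  let F : Set 𝔙 := ρ.lhs.fv ∪ ρ.rhs.fv ∪ ρ.constr.fv
  have hF : F.Finite := ((finite_fv _).union (finite_fv _)).union (finite_fv _)
  -- The fresh variables come from `R₀`, since the pair has to belong to `R₀.sdp`; substitution and
  -- computability refer to `R`.
  obtain ⟨xs, hxs, hxsn, hxsF⟩ := R₀.exists_fresh_vars A.args hA1.over.args F hF
  have hxrest : List.Forall₂ (fun x v => ∃ B, (x ∈ R₀.vars ∧ R₀.vty x = B) ∧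
      R.CompAt (R.C o') B v) xs rest := by
    rw [List.forall₂_iff_get] at hxs hrest ⊢
    exact ⟨hxs.1.trans hrest.1, fun i hi hi' =>
      ⟨_, hxs.2 i hi (hxs.1 ▸ hi), hrest.2 i (hxs.1 ▸ hi) hi'⟩⟩
  have hvty : ∀ {x}, x ∈ R₀.vars → R.vty x = R₀.vty x := fun {x} hx =>
    (hU.agrees₀.vty x ⟨hx, hU.vars (.inl hx)⟩).symm
  -- The rule may be applied to a prefix of the arguments only; `τ` sends the fresh `xs` to the
  -- remaining ones, so `r x₁ ⋯ xₘ` is instantiated to the whole non-computable result.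
  obtain ⟨τ, hτ1, hτ2, hτ3⟩ := exists_subst_update σ hxrest hxsn
  have hτc : ∀ x ∈ xs, R.Computable o' (τ x) := fun x hx => by
    obtain ⟨B, _, h⟩ := hτ2 x hx; exact ⟨B, h⟩
  have hτs : R.IsSubst τ := fun x hx => by
    by_cases hxx : x ∈ xs
    · obtain ⟨B, ⟨h1, rfl⟩, h2⟩ := hτ2 x hxx
      rw [hvty h1]; exact h2.hasType
    · rw [hτ3 x hxx]; exact hσ x hx
  have hτσ : ∀ x ∈ F, τ x = σ x := fun x hx => hτ3 x fun h => hxsF x h hx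
  -- the right-hand side, applied to fresh variables
  have hxsT : List.Forall₂ R₀.HasType (xs.map .var) A.args := by
    rw [List.forall₂_map_left_iff]
    exact hxs.imp fun x B h => h.2 ▸ .var h.1
  have hu : R₀.HasType (PreTerm.apps ρ.rhs (xs.map .var)) (.base A.target) := hA2.apps hxsT
  have hxsτ : (xs.map PreTerm.var).map (subst τ) = rest := by
    rw [List.map_map]; exact hτ1
  have huτ : (PreTerm.apps ρ.rhs (xs.map .var)).subst τ =
      PreTerm.apps (ρ.rhs.subst σ) rest := by
    rw [subst_apps, hxsτ, subst_congr fun x hx => hτσ x (.inl (.inr hx))]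
  have hun : ¬ R.Computable o' ((PreTerm.apps ρ.rhs (xs.map .var)).subst τ) := by
    intro h
    rw [huτ] at h
    have h2 := (hU.hasType hu).subst hτs
    rw [huτ] at h2
    exact hnr (hAtgt ▸ (h.at h2).2)
  have hfvu : ∀ x ∈ (PreTerm.apps ρ.rhs (xs.map .var)).fv, x ∈ ρ.rhs.fv ∨ x ∈ xs := by
    intro x hx
    rcases (fv_apps _ _ _).1 hx with h | ⟨t, ht, h⟩
    · exact .inl h
    · obtain ⟨y, hy, rfl⟩ := List.mem_map.1 ht
      cases h
      exact .inr hy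
  have hssc : ∀ s ∈ ss, R.Computable o' (s.subst σ) := fun s hs =>
    comp_of_forall₂ hargs _ (List.mem_append_left _ (List.mem_map_of_mem hs))
  have hxc : ∀ x ∈ (PreTerm.apps ρ.rhs (xs.map .var)).fv, R.Computable o' (τ x) := by
    intro x hx
    rcases hfvu x hx with h | h
    · rw [hτσ x (.inl (.inr h))]
      rcases ρ.mem_logVars_or h with h' | h'
      · exact IsValue.computable (hr.1 x h')
      · obtain ⟨s, hs, hacc⟩ := hAFP ρ hρ f ss hlhs x h'
        exact hU.computable_of_accSub ho hacc (hssc s hs)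
    · exact hτc x h
  obtain ⟨g, ts, hsub, hgd, hgn, hgp⟩ := hU.exists_minimal_subterm hE hu hτs hxc hun
  obtain ⟨B, hB⟩ := hu.sub hsub
  obtain ⟨As, hgt, _⟩ := Signature.hasType_apps hB
  have hg₀ := hgt.fn_inv.1
  have hgR : g ∈ R.funs := by rw [hU.funs]; exact .inl hg₀
  have hgty := hU.agrees₀.fty g ⟨hg₀, hgR⟩
  have hBR := (hU.hasType hB).subst hτs
  rw [subst_apps] at hgn hBR
  -- The subterm found may have a functional type; `vs` are the computable arguments that saturate
  -- it, and fresh `ys` will stand for them.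
  obtain ⟨vs, hvs, hmin⟩ := exists_minimalNoncomputable hg₀ hBR (by
    simp only [List.mem_map]
    rintro _ ⟨t, ht, rfl⟩
    exact hgp t (properSub_apps_fn.2 ⟨t, ht, sub_refl t⟩)) hgn
  rw [List.length_map, ← hgty] at hvs
  obtain ⟨ys, hys, hysn, hysF⟩ := R₀.exists_fresh_vars ((R₀.fty g).args.drop ts.length)
    (fun C hC => (R₀.fty_over g hg₀).args C (List.mem_of_mem_drop hC)) (F ∪ {x | x ∈ xs})
    (hF.union xs.finite_toSet)
  have hyvs : List.Forall₂ (fun y v => ∃ B, (y ∈ R₀.vars ∧ R₀.vty y = B) ∧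
      R.CompAt (R.C o') B v) ys vs := by
    rw [List.forall₂_iff_get] at hys hvs ⊢
    exact ⟨hys.1.trans hvs.1, fun i hi hi' =>
      ⟨_, hys.2 i hi (hys.1 ▸ hi), hvs.2 i (hys.1 ▸ hi) hi'⟩⟩
  -- Since `ys` avoid both the rule and `xs`, this second update changes neither the rule instance
  -- nor the instances of subterms of `r x₁ ⋯ xₘ`.
  obtain ⟨τ', hτ'1, hτ'2, hτ'3⟩ := exists_subst_update τ hyvs hysn
  have hτ's : R.IsSubst τ' := fun x hx => by
    by_cases hxx : x ∈ ys
    · obtain ⟨B, ⟨h1, rfl⟩, h2⟩ := hτ'2 x hxx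
      rw [hvty h1]; exact h2.hasType
    · rw [hτ'3 x hxx]; exact hτs x hx
  have hτ'τ : ∀ x, x ∈ F ∨ x ∈ xs → τ' x = τ x := fun x hx => hτ'3 x fun h => hysF x h hx
  have hτ'σ : ∀ x ∈ F, τ' x = σ x := fun x hx => (hτ'τ x (.inl hx)).trans (hτσ x hx)
  have hsubτ : ∀ w, (PreTerm.apps ρ.rhs (xs.map .var)).Sub w → w.subst τ' = w.subst τ :=
    fun w hw => subst_congr fun x hx => hτ'τ x
      ((hfvu x (hw.fv_subset hx)).imp (fun h => .inl (.inr h)) id)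
  have htsub : ∀ t ∈ ts, ∀ w, t.Sub w → (PreTerm.apps (.fn g) ts).ProperSub w :=
    fun t ht w hw => properSub_apps_fn.2 ⟨t, ht, hw⟩
  have hysτ : (ys.map PreTerm.var).map (subst τ') = vs := by
    rw [List.map_map]; exact hτ'1
  have htsτ : ts.map (subst τ') = ts.map (subst τ) := List.map_congr_left fun t ht =>
    hsubτ t (hsub.trans (htsub t ht t (sub_refl t)).1)
  have hssτ : ss.map (subst τ') = ss.map (subst σ) := List.map_congr_left fun s hs =>
    subst_congr fun x hx => hτ'σ x
      (.inl (.inl (by rw [hlhs]; exact (fv_apps _ _ _).2 (.inr ⟨s, hs, hx⟩))))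
  have hxsτ' : (xs.map PreTerm.var).map (subst τ') = rest := by
    rw [← hxsτ]
    simp only [List.map_map]
    exact List.map_congr_left fun x hx => hτ'τ x (.inr hx)
  refine ⟨⟨⟨f, ss ++ xs.map .var⟩, ⟨g, ts ++ ys.map .var⟩, ρ.constr, ρ.logVars⟩,
    ⟨ρ, hρ, f, ss, A, xs, g, ts, ys, hlhs, hA1, hxs, hsub, hgd, hys, ?_, ?_, rfl⟩,
    τ', hτ's, ⟨fun x hx => ?_, ?_⟩, rfl, ?_, ?_, ?_⟩
  · exact List.nodup_append'.2 ⟨hxsn, hysn, fun x hx hy => hysF x hy (.inr hx)⟩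
  · intro z hz hzF
    rcases List.mem_append.1 hz with h | h
    · exact hxsF z h hzF
    · exact hysF z h (.inl hzF)
  · rw [hτ'σ x (hx.elim .inr fun h => .inl (.inr h.1))]
    exact (hr.1 x hx).isGroundTheory
  · change R.eval (ρ.constr.subst τ') [] = R.one
    rw [subst_congr fun x hx => hτ'σ x (.inr hx)]
    exact hr.2
  · simpa only [Marked.subst, List.map_append, hssτ, hxsτ'] using hsteps
  · intro w hw
    -- A proper subterm of the right-hand side lies in some `tᵢ`, where minimality applies, or is
    -- one of the `ys`, which is sent to a computable term.
    obtain ⟨t, ht, htw⟩ := properSub_apps_fn.1 hw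
    rcases List.mem_append.1 ht with ht | ht
    · have := htsub t ht w htw
      rw [hsubτ w (hsub.trans this.1)]
      exact hgp w this
    · obtain ⟨y, hy, rfl⟩ := List.mem_map.1 ht
      cases htw
      obtain ⟨B, _, h⟩ := hτ'2 y hy
      exact ⟨B, h⟩
  · simpa only [Marked.subst, List.map_append, htsτ, hysτ] using hmin

/-- Each minimal term that is not computable starts an infinite computable chain. -/
theorem IsMinimalNoncomputable.exists_chain (hAFP : R₀.IsAFP o) (hU : R₀.IsUnion R₁ R)
    (hE : R₀.IsExtension R₁) (ho : o'.Extends o) {m : Marked 𝔉 𝔙}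
    (hm : IsMinimalNoncomputable R₀ R o' m) :
    ∃ d σ, R.IsInfiniteChain R₀.sdp d σ ∧ R.IsComputableChain o' d σ ∧
      (d 0).lhs.head = m.head := by
  choose d hd τ hτ hr hh hs hc hn using fun m : {m // IsMinimalNoncomputable R₀ R o' m} =>
    m.2.exists_sdp hAFP hU hE ho
  -- Each state is the instantiated right-hand side of the pair chosen for the previous state. The
  -- reduction from state `i + 1` to its own left-hand side is thus exactly the link between pairs
  -- `i` and `i + 1`.
  let seq : ℕ → {m // IsMinimalNoncomputable R₀ R o' m} :=
    fun n => Nat.rec ⟨m, hm⟩ (fun _ s => ⟨(d s).rhs.subst (τ s), hn s⟩) n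
  exact ⟨fun i => d (seq i), fun i => τ (seq i),
    ⟨fun i => hd _, fun i => hτ _, fun i => hr _, fun i => hs (seq (i + 1))⟩,
    fun i => hc _, hh (seq 0)⟩

/-- Without public infinite computable chains, the terms of the base system that contain no hidden
symbols are computable. -/
theorem computable_of_no_public_chain (hAFP : R₀.IsAFP o) (hU : R₀.IsUnion R₁ R)
    (hE : R₀.IsExtension R₁) (ho : o'.Extends o) {H : Set 𝔉}
    (h : ¬ ∃ d σ, R.IsInfiniteChain R₀.sdp d σ ∧ R.IsComputableChain o' d σ ∧
      IsPublicChain H d) {t : PreTerm 𝔉 𝔙} {A : Ty 𝔖} (ht : R₀.HasType t A)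
    (hH : Disjoint t.fns H) : R.Computable o' t := by
  induction ht with
  | @fn f hf =>
    by_contra hn
    -- A bare symbol has no arguments whose computability would have to be checked. The chain starts
    -- at this very symbol, which is not hidden because it occurs in the term.
    obtain ⟨vs, _, hm⟩ := exists_minimalNoncomputable (ts := []) hf (hU.hasType (.fn hf))
      (by simp) hn
    obtain ⟨d, σ, h1, h2, h3⟩ := hm.exists_chain hAFP hU hE ho
    dsimp only at h3
    subst h3
    exact h ⟨d, σ, h1, h2, Set.disjoint_left.1 hH rfl⟩
  | var hx => exact ⟨_, CompAt.var (R.C_isRC o') (hU.vars (.inl hx))⟩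
  | app h1 h2 ih1 ih2 =>
    exact ⟨_, Comp.app (hU.hasType (.app h1 h2)) (ih1 (hH.mono_left Set.subset_union_left))
      (ih2 (hH.mono_left Set.subset_union_right))⟩

end Combination

end LCSTRS

end LC

theorem mainTheorem3 {𝔖 𝔉 𝔙 𝔛 : Type*} (R₀ : LC.LCSTRS 𝔖 𝔉 𝔙 𝔛)
    (o : LC.SortOrdering R₀.sorts) (hAFP : R₀.IsAFP o) :
    (∀ H : Set 𝔉, H ⊆ R₀.funs →
      (∀ R₁, R₀.IsPublicExtension H R₁ → ∀ R : LC.LCSTRS 𝔖 𝔉 𝔙 𝔛, R₀.IsUnion R₁ R →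
        ∀ o' : LC.SortOrdering R.sorts, o'.Extends o →
          ¬ ∃ d σ, R.IsInfiniteChain R₀.sdp d σ ∧ R.IsComputableChain o' d σ ∧
            LC.LCSTRS.IsPublicChain H d) →
      R₀.PubliclyComputable o H) ∧
    ((∀ R₁, R₀.IsExtension R₁ → ∀ R : LC.LCSTRS 𝔖 𝔉 𝔙 𝔛, R₀.IsUnion R₁ R →
        ∀ o' : LC.SortOrdering R.sorts, o'.Extends o →
          ¬ ∃ d σ, R.IsInfiniteChain R₀.sdp d σ ∧ R.IsComputableChain o' d σ) →
      R₀.UniversallyComputable o) := by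
  have key : ∀ H : Set 𝔉,
      (∀ R₁, R₀.IsPublicExtension H R₁ → ∀ R : LC.LCSTRS 𝔖 𝔉 𝔙 𝔛, R₀.IsUnion R₁ R →
        ∀ o' : LC.SortOrdering R.sorts, o'.Extends o →
          ¬ ∃ d σ, R.IsInfiniteChain R₀.sdp d σ ∧ R.IsComputableChain o' d σ ∧
            LC.LCSTRS.IsPublicChain H d) →
      R₀.PubliclyComputable o H :=
    fun H h t A ht hH R₁ hE R hU o' ho =>
      LC.LCSTRS.computable_of_no_public_chain hAFP hU hE.1 ho (h R₁ hE R hU o' ho) ht hH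
  refine ⟨fun H _ => key H, fun h t A ht R₁ hE R hU o' ho => ?_⟩
  -- With no hidden symbols every extension, every term and every chain is public.
  refine key ∅ (fun R₁ hE R hU o' ho ⟨d, σ, h1, h2, _⟩ => h R₁ hE.1 R hU o' ho ⟨d, σ, h1, h2⟩)
    t A ht (Set.disjoint_empty _) R₁ ⟨hE, fun _ _ => Set.disjoint_empty _⟩ R hU o' ho
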